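/- Theorem (classification of nonzero five-dimensional noncommutative Heisenberg algebras). An algebra is a finite-dimensional complex vector space $\mathfrak{H}$ with an arbitrary bilinear multiplication; $\mathfrak{H}^2$ is the linear span of all products, and $\mathfrak{Der}\,\mathfrak{H}$ is the space of linear maps $D$ with $D(xy)=D(x)y+xD(y)$. Call $\mathfrak{H}$ a noncommutative Heisenberg algebra if $\dim\mathfrak{H}^2\le 1$ and $\mathfrak{H}^2\mathfrak{H}+\mathfrak{H}\mathfrak{H}^2=0$. Put $$\mathbb{C}_{|\cdot|\le 1}=\{x\in\mathbb{C}: |x|<1\}\cup\{x\in\mathbb{C}: |x|=1,\ \mathrm{Im}\,x\ge 0\},$$ $$\mathbb{C}_{\ge 0}=\{x\in\mathbb{C}: \mathrm{Re}\,x>0\}\cup\{x\in\mathbb{C}: \mathrm{Re}\,x=0,\ \mathrm{Im}\,x\ge 0\},$$ and let $\delta$ be Kronecker's delta. Every five-dimensional noncommutative Heisenberg algebra with nonzero multiplication is isomorphic to exactly one algebra from the following list (different names or different parameter values count as different members of the list, so the listed algebras are pairwise non-isomorphic), each listed algebra is a noncommutative Heisenberg algebra with nonzero multiplication, and the dimension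 of its derivation algebra is the one indicated. Each algebra has a basis $e_1,\dots,e_5$, and the products of basis vectors that are not listed are zero. - $\mathfrak{H}_{01}$: $e_1e_1=e_5$; $\dim\mathfrak{Der}=17$. - $\mathfrak{H}_{02}$: $e_1e_2=-e_5$, $e_2e_1=e_5$, $e_2e_2=e_5$; $\dim\mathfrak{Der}=14$. - $\mathfrak{H}_{03}^{\lambda}$: $e_1e_2=e_5$, $e_2e_1=\lambda e_5$; $\dim\mathfrak{Der}=14+2\delta_{\lambda,-1}$. - $\mathfrak{H}_{04}$: $e_1e_1=e_5$, $e_2e_3=-e_5$, $e_3e_2=e_5$, $e_3e_3=e_5$; $\dim\mathfrak{Der}=10$. - $\mathfrak{H}_{05}^{\lambda}$: $e_1e_1=e_5$, $e_2e_3=e_5$, $e_3e_2=\lambda e_5$; $\dim\mathfrak{Der}=10+2\delta_{\lambda,1}+2\delta_{\lambda,-1}$. - $\mathfrak{H}_{06}$: $e_1e_2=e_5$, $e_2e_3=e_5$; $\dim\mathfrak{Der}=11$. - $\mathfrak{H}_{07}$: $e_1e_3=e_5$, $e_2e_2=-e_5$, $e_2e_3=-e_5$, $e_3e_1=e_5$,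 $e_3e_2=e_5$; $\dim\mathfrak{Der}=10$. - $\mathfrak{H}_{08}$: $e_1e_4=-e_5$, $e_2e_3=e_5$, $e_2e_4=e_5$, $e_3e_2=-e_5$, $e_3e_3=-e_5$, $e_4e_1=e_5$, $e_4e_2=e_5$; $\dim\mathfrak{Der}=7$. - $\mathfrak{H}_{09}^{\lambda}$, $\lambda\ne -1,0$: $e_1e_3=e_5$, $e_2e_4=e_5$, $e_3e_1=\lambda e_5$, $e_3e_2=e_5$, $e_4e_2=\lambda e_5$; $\dim\mathfrak{Der}=7+2\delta_{\lambda,1}$. - $\mathfrak{H}_{10}$: $e_1e_1=e_5$, $e_2e_3=e_5$, $e_3e_4=e_5$; $\dim\mathfrak{Der}=8$. - $\mathfrak{H}_{11}$: $e_1e_1=e_5$, $e_2e_4=e_5$, $e_3e_3=-e_5$, $e_3e_4=-e_5$, $e_4e_2=e_5$, $e_4e_3=e_5$; $\dim\mathfrak{Der}=7$. - $\mathfrak{H}_{12}$: $e_1e_2=-e_5$, $e_2e_1=e_5$, $e_2e_2=e_5$, $e_3e_4=-e_5$, $e_4e_3=e_5$, $e_4e_4=e_5$; $\dim\mathfrak{Der}=9$.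 - $\mathfrak{H}_{13}^{\lambda;\mu}$, $\lambda-\mu\in\mathbb{C}_{\ge 0}$: $e_1e_2=e_5$, $e_2e_1=\mu e_5$, $e_3e_4=e_5$, $e_4e_3=\lambda e_5$; $\dim\mathfrak{Der}=7+2\delta_{\lambda,\mu}+2\delta_{\lambda,-1}\delta_{\mu,-1}+2\delta_{\lambda,1}\delta_{\mu,1}+2\delta_{\lambda,-1}+2\delta_{\mu,-1}$. - $\mathfrak{H}_{14}^{\lambda}$: $e_1e_2=e_5$, $e_2e_1=\lambda e_5$, $e_3e_4=-e_5$, $e_4e_3=e_5$, $e_4e_4=e_5$; $\dim\mathfrak{Der}=7+4\delta_{\lambda,-1}$. - $\mathfrak{H}_{15}$: $e_1e_2=e_5$, $e_2e_3=e_5$, $e_3e_4=e_5$; $\dim\mathfrak{Der}=7$. Here all parameters $\lambda,\mu$ range over $\mathbb{C}_{|\cdot|\le 1}$. -/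

import Mathlib

namespace NCHeisenberg

section General

variable {V : Type*} [AddCommGroup V] [Module ℂ V] {W : Type*} [AddCommGroup W] [Module ℂ W]

/-- The square of the algebra with underlying space `V` and bilinear multiplication `m`: the linear
span of all products. -/
def square (m : V →ₗ[ℂ] V →ₗ[ℂ] V) : Submodule ℂ V :=
  Submodule.map₂ m ⊤ ⊤

/-- `(V, m)` is a noncommutative Heisenberg algebra: its square has dimension at most one and
`V² V + V V² = 0`. -/
structure IsNCHeisenberg (m : V →ₗ[ℂ] V →ₗ[ℂ] V) : Prop where
  rank_square_le : Module.rank ℂ (square m) ≤ 1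
  annihilates : Submodule.map₂ m (square m) ⊤ ⊔ Submodule.map₂ m ⊤ (square m) = ⊥

/-- Isomorphism of the algebras `(V, m)` and `(W, m')`. -/
def AlgIso (m : V →ₗ[ℂ] V →ₗ[ℂ] V) (m' : W →ₗ[ℂ] W →ₗ[ℂ] W) : Prop :=
  ∃ e : V ≃ₗ[ℂ] W, ∀ x y : V, e (m x y) = m' (e x) (e y)

/-- The space of derivations of the algebra `(V, m)`. -/
def derivations (m : V →ₗ[ℂ] V →ₗ[ℂ] V) : Submodule ℂ (Module.End ℂ V) where
  carrier := {D | ∀ x y : V, D (m x y) = m (D x) y + m x (D y)}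
  zero_mem' := by
    intro x y
    simp
  add_mem' := by
    intro D E hD hE x y
    simp only [Set.mem_setOf_eq] at hD hE
    simp only [LinearMap.add_apply, map_add, hD x y, hE x y]
    abel
  smul_mem' := by
    intro c D hD x y
    simp only [Set.mem_setOf_eq] at hD
    simp only [LinearMap.smul_apply, map_smul, hD x y, smul_add]

end General

/-- The set of `x` with `|x| < 1`, or `|x| = 1` and `Im x ≥ 0`. -/
def unitDiscHalf : Set ℂ := {x | ‖x‖ < 1} ∪ {x | ‖x‖ = 1 ∧ 0 ≤ x.im}

/-- The set of `x` with `Re x > 0`, or `Re x = 0` and `Im x ≥ 0`. -/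
def halfPlane : Set ℂ := {x | 0 < x.re} ∪ {x | x.re = 0 ∧ 0 ≤ x.im}

/-- The algebra structure on `ℂ⁵` with `eᵢ eⱼ = Aᵢⱼ e₅` for `1 ≤ i, j ≤ 4`, all other products of
basis vectors being zero. -/
noncomputable def mulOfMatrix (A : Matrix (Fin 4) (Fin 4) ℂ) :
    (Fin 5 → ℂ) →ₗ[ℂ] (Fin 5 → ℂ) →ₗ[ℂ] (Fin 5 → ℂ) :=
  LinearMap.mk₂ ℂ
    (fun x y => (∑ i : Fin 4, ∑ j : Fin 4, x i.castSucc * A i j * y j.castSucc) •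
      (Pi.single (Fin.last 4) 1 : Fin 5 → ℂ))
    (by intro x x' y; simp only [Pi.add_apply, add_mul, Finset.sum_add_distrib, add_smul])
    (by intro c x y
        simp only [Pi.smul_apply, smul_eq_mul, mul_assoc, ← Finset.mul_sum, mul_smul])
    (by intro x y y'; simp only [Pi.add_apply, mul_add, Finset.sum_add_distrib, add_smul])
    (by intro c x y
        simp only [Pi.smul_apply, smul_eq_mul, mul_left_comm _ c, ← Finset.mul_sum, mul_smul])

/-- The names of the algebras in the list, with their parameters. -/
inductive Label : Type
  | h01 | h02
  | h03 (l : ℂ)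
  | h04
  | h05 (l : ℂ)
  | h06 | h07 | h08
  | h09 (l : ℂ)
  | h10 | h11 | h12
  | h13 (l m : ℂ)
  | h14 (l : ℂ)
  | h15

namespace Label

/-- The restrictions on the parameters. -/
def Admissible : Label → Prop
  | h03 l => l ∈ unitDiscHalf
  | h05 l => l ∈ unitDiscHalf
  | h09 l => l ∈ unitDiscHalf ∧ l ≠ -1 ∧ l ≠ 0
  | h13 l m => l ∈ unitDiscHalf ∧ m ∈ unitDiscHalf ∧ l - m ∈ halfPlane
  | h14 l => l ∈ unitDiscHalf
  | _ => True

/-- The multiplication table: the `(i, j)` entry is the coefficient of `e₅` in `eᵢ eⱼ`. -/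
def table : Label → Matrix (Fin 4) (Fin 4) ℂ
  | h01 => !![1, 0, 0, 0; 0, 0, 0, 0; 0, 0, 0, 0; 0, 0, 0, 0]
  | h02 => !![0, -1, 0, 0; 1, 1, 0, 0; 0, 0, 0, 0; 0, 0, 0, 0]
  | h03 l => !![0, 1, 0, 0; l, 0, 0, 0; 0, 0, 0, 0; 0, 0, 0, 0]
  | h04 => !![1, 0, 0, 0; 0, 0, -1, 0; 0, 1, 1, 0; 0, 0, 0, 0]
  | h05 l => !![1, 0, 0, 0; 0, 0, 1, 0; 0, l, 0, 0; 0, 0, 0, 0]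
  | h06 => !![0, 1, 0, 0; 0, 0, 1, 0; 0, 0, 0, 0; 0, 0, 0, 0]
  | h07 => !![0, 0, 1, 0; 0, -1, -1, 0; 1, 1, 0, 0; 0, 0, 0, 0]
  | h08 => !![0, 0, 0, -1; 0, 0, 1, 1; 0, -1, -1, 0; 1, 1, 0, 0]
  | h09 l => !![0, 0, 1, 0; 0, 0, 0, 1; l, 1, 0, 0; 0, l, 0, 0]
  | h10 => !![1, 0, 0, 0; 0, 0, 1, 0; 0, 0, 0, 1; 0, 0, 0, 0]
  | h11 => !![1, 0, 0, 0; 0, 0, 0, 1; 0, 0, -1, -1; 0, 1, 1, 0]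
  | h12 => !![0, -1, 0, 0; 1, 1, 0, 0; 0, 0, 0, -1; 0, 0, 1, 1]
  | h13 l m => !![0, 1, 0, 0; m, 0, 0, 0; 0, 0, 0, 1; 0, 0, l, 0]
  | h14 l => !![0, 1, 0, 0; l, 0, 0, 0; 0, 0, 0, -1; 0, 0, 1, 1]
  | h15 => !![0, 1, 0, 0; 0, 0, 1, 0; 0, 0, 0, 1; 0, 0, 0, 0]

/-- The algebra with the given name. -/
noncomputable def mul (L : Label) : (Fin 5 → ℂ) →ₗ[ℂ] (Fin 5 → ℂ) →ₗ[ℂ] (Fin 5 → ℂ) :=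
  mulOfMatrix L.table

/-- Kronecker's delta. -/
noncomputable def delta (x y : ℂ) : ℕ := if x = y then 1 else 0

/-- The tabulated dimension of the derivation algebra. -/
noncomputable def derDim : Label → ℕ
  | h01 => 17
  | h02 => 14
  | h03 l => 14 + 2 * delta l (-1)
  | h04 => 10
  | h05 l => 10 + 2 * delta l 1 + 2 * delta l (-1)
  | h06 => 11
  | h07 => 10
  | h08 => 7
  | h09 l => 7 + 2 * delta l 1
  | h10 => 8
  | h11 => 7
  | h12 => 9
  | h13 l m => 7 + (2 * delta l m + 2 * (delta l (-1) * delta m (-1)) +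
      2 * (delta l 1 * delta m 1) + 2 * delta l (-1) + 2 * delta m (-1))
  | h14 l => 7 + 4 * delta l (-1)
  | h15 => 7

end Label

end NCHeisenberg

/-! If z spans the square, the multiplication is `m x y = b x y • z` for a bilinear form b that
vanishes when either argument is z. So b lives on a four-dimensional complement of z, and congruent
matrices of b give isomorphic algebras. Existence is therefore the classification of 4×4 complex
matrices up to congruence, and the zero matrix is excluded because m ≠ 0.

The classification is by induction on the size, using the pencil A - l Aᵀ. It is singular for some
l, and transposing replaces l by l⁻¹, so l can be taken in `unitDiscHalf`. A left kernel vector v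
satisfies b(v, ·) = l b(·, v). There are three outcomes (`exists_cong_normalized`): v is in the
radical on both sides; or b(v, v) ≠ 0, so l = 1 and v splits off; or v pairs with exactly one
further basis vector, which leaves a two-dimensional border around a form of size smaller by two.
The smaller form is put in canonical form, and the border is then cleared as far as possible. The
coupling that cannot be cleared produces the indecomposable entries of the table.

Derivations are computed from infinitesimal isometries: the dimension is 5 plus the dimension of {d
| dᵀA + Ad = 0}, which is solved entry by entry.

For uniqueness, two invariants suffice: the dimension of the derivation algebra and the set of t in
`unitDiscHalf` at which the pencil, cut down to the part of the space that carries the form, is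
singular. An isomorphism induces PᵀBP = cA with c ≠ 0, which transports singular parameters
(`det_sub_smul_transpose_eq_zero_of_smul`). The derivation dimension already fixes the size of that
part, except for the value 11, where `h06` is told apart by its identically vanishing determinant
(`not_algIso_h06`). -/

namespace NCHeisenberg

open Matrix

/-! ### Congruence and bordered matrices -/

/-- Congruence of square complex matrices. -/
def Cong {n : ℕ} (A B : Matrix (Fin n) (Fin n) ℂ) : Prop :=
  ∃ P : Matrix (Fin n) (Fin n) ℂ, P.det ≠ 0 ∧ Pᵀ * A * P = B

namespace Cong

variable {n : ℕ} {A B C : Matrix (Fin n) (Fin n) ℂ}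

theorem refl (A : Matrix (Fin n) (Fin n) ℂ) : Cong A A := ⟨1, by simp, by simp⟩

theorem trans (h : Cong A B) (h' : Cong B C) : Cong A C := by
  obtain ⟨P, hP, rfl⟩ := h
  obtain ⟨Q, hQ, rfl⟩ := h'
  exact ⟨P * Q, by simp [hP, hQ], by simp only [Matrix.transpose_mul, Matrix.mul_assoc]⟩

theorem submatrix (A : Matrix (Fin n) (Fin n) ℂ) (e : Equiv.Perm (Fin n)) :
    Cong A (A.submatrix e e) := by
  refine ⟨(1 : Matrix (Fin n) (Fin n) ℂ).submatrix id e, ?_, ?_⟩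
  · rw [Matrix.det_permute']
    simp
  · ext i j
    simp [Matrix.mul_apply, Matrix.one_apply]

theorem of_eq (h : A = B) : Cong A B := h ▸ refl A

theorem of_submatrix (e : Equiv.Perm (Fin n)) (h : A.submatrix e e = B) : Cong A B :=
  h ▸ submatrix A e

end Cong

/-- The square matrix with corner `a`, first row `r`, first column `c` and remaining block `N`. -/
def blk {n : ℕ} (a : ℂ) (r c : Fin n → ℂ) (N : Matrix (Fin n) (Fin n) ℂ) :
    Matrix (Fin (n + 1)) (Fin (n + 1)) ℂ :=
  Matrix.of (vecCons (vecCons a r) fun i => vecCons (c i) (N i))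

section blk

variable {n : ℕ} (a a' : ℂ) (r c r' c' : Fin n → ℂ) (N N' : Matrix (Fin n) (Fin n) ℂ)

@[simp] theorem blk_zero_zero : blk a r c N 0 0 = a := rfl
@[simp] theorem blk_zero_succ (j : Fin n) : blk a r c N 0 j.succ = r j := rfl
@[simp] theorem blk_succ_zero (i : Fin n) : blk a r c N i.succ 0 = c i := rfl
@[simp] theorem blk_succ_succ (i j : Fin n) : blk a r c N i.succ j.succ = N i j := rfl

theorem eq_blk (A : Matrix (Fin (n + 1)) (Fin (n + 1)) ℂ) :
    A = blk (A 0 0) (fun j => A 0 j.succ) (fun i => A i.succ 0) (A.submatrix Fin.succ Fin.succ) := by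
  ext i j
  refine Fin.cases ?_ (fun i => ?_) i <;> refine Fin.cases ?_ (fun j => ?_) j <;> simp

theorem blk_transpose : (blk a r c N)ᵀ = blk a c r Nᵀ := by
  ext i j
  refine Fin.cases ?_ (fun i => ?_) i <;> refine Fin.cases ?_ (fun j => ?_) j <;> simp

theorem blk_mul : blk a r c N * blk a' r' c' N' =
    blk (a * a' + r ⬝ᵥ c') (a • r' + r ᵥ* N') (a' • c + N *ᵥ c') (vecMulVec c r' + N * N') := by
  ext i j
  refine Fin.cases ?_ (fun i => ?_) i <;> refine Fin.cases ?_ (fun j => ?_) j <;>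
    simp [Matrix.mul_apply, Fin.sum_univ_succ, dotProduct, vecMul, mulVec, vecMulVec_apply, mul_comm]

theorem blk_fin_one (r c : Fin 1 → ℂ) (N : Matrix (Fin 1) (Fin 1) ℂ) :
    blk a r c N = !![a, r 0; c 0, N 0 0] := by
  ext i j
  fin_cases i <;> fin_cases j <;> rfl

theorem blk_fin_two (r c : Fin 2 → ℂ) (N : Matrix (Fin 2) (Fin 2) ℂ) :
    blk a r c N = !![a, r 0, r 1; c 0, N 0 0, N 0 1; c 1, N 1 0, N 1 1] := by
  ext i j
  fin_cases i <;> fin_cases j <;> rfl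

theorem blk_fin_three (r c : Fin 3 → ℂ) (N : Matrix (Fin 3) (Fin 3) ℂ) :
    blk a r c N = !![a, r 0, r 1, r 2; c 0, N 0 0, N 0 1, N 0 2; c 1, N 1 0, N 1 1, N 1 2;
      c 2, N 2 0, N 2 1, N 2 2] := by
  ext i j
  fin_cases i <;> fin_cases j <;> rfl

theorem det_blk_of_col_eq_zero : (blk a r 0 N).det = a * N.det := by
  rw [Matrix.det_succ_column_zero, Fin.sum_univ_succ]
  simp
  left
  congr 1

/-- The change of basis fixes the first vector and acts by Q on the others. -/
theorem Cong.blk_right {N : Matrix (Fin n) (Fin n) ℂ} (Q : Matrix (Fin n) (Fin n) ℂ)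
    (hQ : Q.det ≠ 0) : Cong (blk a r c N) (blk a (r ᵥ* Q) (Qᵀ *ᵥ c) (Qᵀ * N * Q)) := by
  refine ⟨blk 1 0 0 Q, by simpa [det_blk_of_col_eq_zero] using hQ, ?_⟩
  rw [blk_transpose, blk_mul, blk_mul]
  simp

theorem Cong.blk {N N' : Matrix (Fin n) (Fin n) ℂ} (h : Cong N N') (a : ℂ) :
    Cong (blk a 0 0 N) (blk a 0 0 N') := by
  obtain ⟨Q, hQ, rfl⟩ := h
  simpa using Cong.blk_right a 0 0 Q hQ (N := N)

end blk

/-! ### The singular pencil and the reduction step -/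

theorem exists_det_ne_zero_col_zero {n : ℕ} {v : Fin (n + 1) → ℂ} (hv : v ≠ 0) :
    ∃ P : Matrix (Fin (n + 1)) (Fin (n + 1)) ℂ, P.det ≠ 0 ∧ P.col 0 = v := by
  obtain ⟨i, hi⟩ := Function.ne_iff.1 hv
  refine ⟨((1 : Matrix (Fin (n + 1)) (Fin (n + 1)) ℂ).updateCol i v).submatrix id
    (Equiv.swap 0 i), ?_, ?_⟩
  · rw [Matrix.det_permute', ← Matrix.cramer_apply, Matrix.cramer_one]
    simpa using hi
  · ext j
    simp

/-- Together with `eq_of_mul_eq_one_of_mem_unitDiscHalf` this says that `unitDiscHalf` without 0 is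
a fundamental domain for inversion on the nonzero complex numbers. -/
theorem mem_unitDiscHalf_or_inv {x : ℂ} (hx : x ≠ 0) :
    x ∈ unitDiscHalf ∨ x⁻¹ ∈ unitDiscHalf := by
  have hpos : 0 < ‖x‖ := norm_pos_iff.2 hx
  rcases lt_trichotomy ‖x‖ 1 with h | h | h
  · exact .inl (.inl h)
  · rcases le_total 0 x.im with h' | h'
    · exact .inl (.inr ⟨h, h'⟩)
    · refine .inr (.inr ⟨by simp [h], ?_⟩)
      rw [Complex.inv_im, Complex.normSq_eq_norm_sq, h]
      simpa using h'
  · refine .inr (.inl ?_)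
    show ‖x⁻¹‖ < 1
    rw [norm_inv]
    exact inv_lt_one_of_one_lt₀ h

theorem zero_mem_unitDiscHalf : (0 : ℂ) ∈ unitDiscHalf := .inl (by simp)

theorem one_mem_unitDiscHalf : (1 : ℂ) ∈ unitDiscHalf := .inr (by simp)

theorem neg_one_mem_unitDiscHalf : (-1 : ℂ) ∈ unitDiscHalf := .inr (by simp)

/-- A singular A allows l = 0. Otherwise any eigenvalue of the asymmetry A(Aᵀ)⁻¹ works, and so does
its inverse, because A - l⁻¹Aᵀ is a multiple of the transpose of A - lAᵀ. -/
theorem exists_det_sub_smul_transpose_eq_zero {n : ℕ} (A : Matrix (Fin (n + 1)) (Fin (n + 1)) ℂ) :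
    ∃ l ∈ unitDiscHalf, (A - l • Aᵀ).det = 0 := by
  by_cases hA : A.det = 0
  · exact ⟨0, zero_mem_unitDiscHalf, by simpa using hA⟩
  have hu : IsUnit Aᵀ.det := isUnit_iff_ne_zero.2 (by simpa using hA)
  obtain ⟨l, hl⟩ := Module.End.exists_eigenvalue (Matrix.toLin' (A * Aᵀ⁻¹))
  have h1 : (A - l • Aᵀ).det = 0 := by
    obtain ⟨v, hv⟩ := hl.exists_hasEigenvector
    have h2 : (A * Aᵀ⁻¹ - l • 1).det = 0 := by
      rw [← Matrix.exists_mulVec_eq_zero_iff]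
      refine ⟨v, hv.2, ?_⟩
      have := hv.apply_eq_smul
      rw [Matrix.toLin'_apply] at this
      rw [Matrix.sub_mulVec, this]
      simp [Matrix.smul_mulVec]
    have h3 : A - l • Aᵀ = (A * Aᵀ⁻¹ - l • 1) * Aᵀ := by
      rw [Matrix.sub_mul, Matrix.mul_assoc, Matrix.nonsing_inv_mul _ hu]
      simp
    rw [h3, Matrix.det_mul, h2, zero_mul]
  have hl0 : l ≠ 0 := by
    rintro rfl
    exact hA (by simpa using h1)
  rcases mem_unitDiscHalf_or_inv hl0 with h | h
  · exact ⟨l, h, h1⟩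
  · refine ⟨l⁻¹, h, ?_⟩
    have h4 : (A - l⁻¹ • Aᵀ) = (-l⁻¹) • (A - l • Aᵀ)ᵀ := by
      ext i j
      simp
      field_simp
      ring
    rw [h4, Matrix.det_smul, Matrix.det_transpose, h1, mul_zero]

/-- A left kernel vector of A - lAᵀ is taken as first basis vector. The corner lies in both the
first row and the first column, hence a = la. -/
theorem exists_cong_row_eq_smul_col {n : ℕ} (A : Matrix (Fin (n + 1)) (Fin (n + 1)) ℂ) :
    ∃ l ∈ unitDiscHalf, ∃ a c N, Cong A (blk a (l • c) c N) ∧ a = l * a := by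
  obtain ⟨l, hl, h⟩ := exists_det_sub_smul_transpose_eq_zero A
  obtain ⟨v, hv, h⟩ := Matrix.exists_vecMul_eq_zero_iff.2 h
  obtain ⟨P, hP, hPv⟩ := exists_det_ne_zero_col_zero hv
  have key : ∀ j, (Pᵀ * A * P) 0 j = l * (Pᵀ * A * P) j 0 := by
    intro j
    have h1 : (Pᵀ * A * P) 0 j = (v ᵥ* A) ⬝ᵥ P.col j := by
      rw [← hPv, Matrix.mul_apply_eq_vecMul, Matrix.mul_apply_eq_vecMul]
      rfl
    have h2 : (Pᵀ * A * P) j 0 = (v ᵥ* Aᵀ) ⬝ᵥ P.col j := by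
      rw [← hPv, ← Matrix.transpose_apply (Pᵀ * A * P), Matrix.transpose_mul,
        Matrix.transpose_mul, Matrix.transpose_transpose, ← Matrix.mul_assoc,
        Matrix.mul_apply_eq_vecMul, Matrix.mul_apply_eq_vecMul]
      rfl
    rw [Matrix.vecMul_sub, Matrix.vecMul_smul, sub_eq_zero] at h
    rw [h1, h2, h, smul_dotProduct, smul_eq_mul]
  refine ⟨l, hl, (Pᵀ * A * P) 0 0, fun i => (Pᵀ * A * P) i.succ 0,
    (Pᵀ * A * P).submatrix Fin.succ Fin.succ, ⟨P, hP, ?_⟩, key 0⟩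
  conv_lhs => rw [eq_blk (Pᵀ * A * P)]
  congr 1
  ext j
  exact key j.succ

/-- Equality of row and column makes the left and right orthogonal complements of the first vector
coincide, so one Gram–Schmidt step clears both. -/
theorem cong_split {n : ℕ} (a : ℂ) (c : Fin n → ℂ) (N : Matrix (Fin n) (Fin n) ℂ) (ha : a ≠ 0) :
    ∃ N', Cong (blk a c c N) (blk 1 0 0 N') := by
  obtain ⟨b, hb⟩ := IsAlgClosed.exists_pow_nat_eq a (n := 2) two_pos
  have hb0 : b ≠ 0 := by
    rintro rfl
    exact ha (by simpa using hb.symm)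
  suffices h : ∃ N', (blk b⁻¹ (-a⁻¹ • c) 0 1)ᵀ * blk a c c N * blk b⁻¹ (-a⁻¹ • c) 0 1 =
      blk 1 0 0 N' by
    obtain ⟨N', h⟩ := h
    exact ⟨N', _, by simpa [det_blk_of_col_eq_zero] using hb0, h⟩
  rw [blk_transpose, blk_mul, blk_mul]
  -- The remaining block is left as a metavariable, which `congr 1` assigns from the computed
  -- product.
  apply Exists.intro
  congr 1
  · simp [← hb]
    field_simp
  · ext i
    simp
    field_simp
    simp
  · ext i
    simp
    field_simp
    simp

theorem exists_cong_normalized {n : ℕ} (A : Matrix (Fin (n + 2)) (Fin (n + 2)) ℂ) :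
    (∃ N, Cong A (blk 0 0 0 N)) ∨ (∃ N, Cong A (blk 1 0 0 N)) ∨
    ∃ l ∈ unitDiscHalf, ∃ s q p N, Cong A
      (blk 0 (vecCons l 0) (vecCons 1 0) (blk s q p N)) := by
  obtain ⟨l, hl, a, c, N, h, ha⟩ := exists_cong_row_eq_smul_col A
  by_cases ha0 : a = 0
  · subst ha0
    by_cases hc : c = 0
    · subst hc
      exact .inl ⟨N, by simpa using h⟩
    · right; right
      obtain ⟨R, hR, hRc⟩ := exists_det_ne_zero_col_zero hc
      have hu : IsUnit R.det := isUnit_iff_ne_zero.2 hR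
      have h1 : R⁻¹ *ᵥ c = vecCons 1 0 := by
        have : R *ᵥ (vecCons 1 0) = c := by
          rw [← hRc]
          ext i
          simp [mulVec, dotProduct, Fin.sum_univ_succ]
        rw [← this, Matrix.mulVec_mulVec, Matrix.nonsing_inv_mul R hu, Matrix.one_mulVec]
      -- A basis change Q sends the column c to Qᵀc, so Q is the transpose of R⁻¹, and R⁻¹c is the
      -- first unit vector.
      have h2 := Cong.blk_right 0 (l • c) c R⁻¹ᵀ (N := N)
        (by simpa using hR)
      rw [Matrix.transpose_transpose, Matrix.vecMul_transpose, Matrix.mulVec_smul, h1] at h2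
      have h3 := h.trans h2
      rw [eq_blk (R⁻¹ * N * R⁻¹ᵀ)] at h3
      have h4 : l • vecCons 1 0 = (vecCons l 0 : Fin (n + 1) → ℂ) := by
        ext i
        refine Fin.cases ?_ (fun i => ?_) i <;> simp
      rw [h4] at h3
      exact ⟨l, hl, _, _, _, _, h3⟩
  · right; left
    have hl1 : l = 1 := by
      have : (1 - l) * a = 0 := by linear_combination ha
      simpa [ha0, sub_eq_zero, eq_comm (a := l)] using this
    subst hl1
    obtain ⟨N', h'⟩ := cong_split a c N ha0
    exact ⟨N', h.trans (by simpa using h')⟩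

/-- The first vector pairs only with the second, so changing the remaining vectors leaves the outer
border untouched and only transforms q and p. -/
theorem cong_double_border {n : ℕ} (l s : ℂ) (q p : Fin n → ℂ) {N N' : Matrix (Fin n) (Fin n) ℂ}
    (h : Cong N N') : ∃ q' p', Cong (blk 0 (vecCons l 0) (vecCons 1 0) (blk s q p N))
      (blk 0 (vecCons l 0) (vecCons 1 0) (blk s q' p' N')) := by
  obtain ⟨Q, hQ, rfl⟩ := h
  refine ⟨q ᵥ* Q, Qᵀ *ᵥ p, blk 1 0 0 (blk 1 0 0 Q), by simpa [det_blk_of_col_eq_zero] using hQ, ?_⟩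
  simp only [blk_transpose, blk_mul]
  congr 1
  · simp
  · ext i
    refine Fin.cases ?_ (fun i => ?_) i <;>
      simp [vecMul, dotProduct, Fin.sum_univ_succ]
  · ext i
    refine Fin.cases ?_ (fun i => ?_) i <;>
      simp [mulVec, dotProduct, Fin.sum_univ_succ]
  · simp [blk_mul]

/-! ### Canonical forms in dimensions one, two and three -/

/-- The canonical forms of bilinear forms on a space of dimension two. -/
inductive Canonical₂ : Matrix (Fin 2) (Fin 2) ℂ → Prop
  | zero : Canonical₂ !![0, 0; 0, 0]
  | one : Canonical₂ !![1, 0; 0, 0]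
  | gam : Canonical₂ !![0, -1; 1, 1]
  | hyp (l : ℂ) (hl : l ∈ unitDiscHalf) : Canonical₂ !![0, 1; l, 0]

theorem cong_fin_one (A : Matrix (Fin 1) (Fin 1) ℂ) : Cong A !![0] ∨ Cong A !![1] := by
  by_cases h : A 0 0 = 0
  · left
    refine .of_eq ?_
    ext i j
    fin_cases i; fin_cases j
    simpa using h
  · right
    obtain ⟨b, hb⟩ := IsAlgClosed.exists_pow_nat_eq (A 0 0) (n := 2) two_pos
    have hb0 : b ≠ 0 := by
      rintro rfl
      exact h (by simpa using hb.symm)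
    refine ⟨!![b⁻¹], by simpa using hb0, ?_⟩
    ext i j
    fin_cases i; fin_cases j
    simp [Matrix.mul_apply]
    grind

theorem exists_canonical₂ (A : Matrix (Fin 2) (Fin 2) ℂ) : ∃ B, Canonical₂ B ∧ Cong A B := by
  rcases exists_cong_normalized A with ⟨N, h⟩ | ⟨N, h⟩ | ⟨l, hl, s, q, p, N, h⟩
  · rcases cong_fin_one N with hN | hN <;>
      replace h := h.trans (hN.blk 0) <;> rw [blk_fin_one] at h
    · exact ⟨_, .zero, h⟩
    · refine ⟨_, .one, h.trans (.of_submatrix (Equiv.swap 0 1) ?_)⟩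
      ext i j
      fin_cases i <;> fin_cases j <;> rfl
  · rcases cong_fin_one N with hN | hN <;>
      replace h := h.trans (hN.blk 1) <;> rw [blk_fin_one] at h
    · exact ⟨_, .one, h⟩
    -- The isotropic vectors e₁ + ie₂ and (e₁ - ie₂)/2 form a hyperbolic pair for the sum of two
    -- squares.
    · refine ⟨_, .hyp 1 one_mem_unitDiscHalf, h.trans
        ⟨!![1, 1 / 2; Complex.I, -Complex.I / 2], ?_, ?_⟩⟩
      · simp [Matrix.det_fin_two]
        grind [Complex.I_ne_zero]
      · ext i j
        fin_cases i <;> fin_cases j <;> simp [Matrix.mul_apply, Fin.sum_univ_succ] <;>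
          grind [Complex.I_mul_I]
  · rw [blk_fin_one] at h
    simp only [cons_val_zero, blk_zero_zero] at h
    by_cases hl1 : l = -1
    · by_cases hs : s = 0
      · refine ⟨_, .hyp l hl, h.trans ⟨!![0, 1; 1, 0], by simp, ?_⟩⟩
        ext i j
        fin_cases i <;> fin_cases j <;> simp [Matrix.mul_apply, Fin.sum_univ_succ, hs]
      · obtain ⟨b, hb⟩ := IsAlgClosed.exists_pow_nat_eq s (n := 2) two_pos
        have hb0 : b ≠ 0 := by
          rintro rfl
          exact hs (by simpa using hb.symm)
        refine ⟨_, .gam, h.trans ⟨!![b, 0; 0, b⁻¹], by simp [hb0], ?_⟩⟩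
        ext i j
        fin_cases i <;> fin_cases j <;> simp [Matrix.mul_apply, Fin.sum_univ_succ, hl1] <;>
          grind
    · have hl2 : 1 + l ≠ 0 := fun h => hl1 (by linear_combination h)
      -- Adding xe₁ to e₂ changes s by x(1 + l), so s can be removed unless l = -1.
      refine ⟨_, .hyp l hl, h.trans ⟨!![-s / (1 + l), 1; 1, 0], by simp, ?_⟩⟩
      ext i j
      fin_cases i <;> fin_cases j <;> simp [Matrix.mul_apply, Fin.sum_univ_succ] <;>
        grind

/-- The canonical forms of bilinear forms on a space of dimension three. -/
inductive Canonical₃ : Matrix (Fin 3) (Fin 3) ℂ → Prop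
  | zero : Canonical₃ !![0, 0, 0; 0, 0, 0; 0, 0, 0]
  | one : Canonical₃ !![1, 0, 0; 0, 0, 0; 0, 0, 0]
  | gam : Canonical₃ !![0, -1, 0; 1, 1, 0; 0, 0, 0]
  | hyp (l : ℂ) (hl : l ∈ unitDiscHalf) : Canonical₃ !![0, 1, 0; l, 0, 0; 0, 0, 0]
  | oneGam : Canonical₃ !![1, 0, 0; 0, 0, -1; 0, 1, 1]
  | oneHyp (l : ℂ) (hl : l ∈ unitDiscHalf) : Canonical₃ !![1, 0, 0; 0, 0, 1; 0, l, 0]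
  | nil : Canonical₃ !![0, 1, 0; 0, 0, 1; 0, 0, 0]
  | gam₃ : Canonical₃ !![0, 0, 1; 0, -1, -1; 1, 1, 0]

theorem exists_canonical₃_of_blk_zero (N : Matrix (Fin 2) (Fin 2) ℂ) :
    ∃ B, Canonical₃ B ∧ Cong (blk 0 0 0 N) B := by
  obtain ⟨B, hB, h⟩ := exists_canonical₂ N
  replace h := h.blk 0
  rw [blk_fin_two 0 _ _ B] at h
  cases hB with
  | zero => exact ⟨_, .zero, h⟩
  | one =>
    refine ⟨_, .one, h.trans (.of_submatrix (Equiv.swap 0 1) ?_)⟩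
    ext i j
    fin_cases i <;> fin_cases j <;> rfl
  | gam =>
    refine ⟨_, .gam, h.trans (.of_submatrix (finRotate 3) ?_)⟩
    ext i j
    fin_cases i <;> fin_cases j <;> rfl
  | hyp l hl =>
    refine ⟨_, .hyp l hl, h.trans (.of_submatrix (finRotate 3) ?_)⟩
    ext i j
    fin_cases i <;> fin_cases j <;> rfl

theorem exists_canonical₃_of_blk_one (N : Matrix (Fin 2) (Fin 2) ℂ) :
    ∃ B, Canonical₃ B ∧ Cong (blk 1 0 0 N) B := by
  obtain ⟨B, hB, h⟩ := exists_canonical₂ N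
  replace h := h.blk 1
  rw [blk_fin_two 1 _ _ B] at h
  cases hB with
  | zero => exact ⟨_, .one, h⟩
  | one =>
    refine ⟨_, .hyp 1 one_mem_unitDiscHalf, h.trans
      ⟨!![1, 1 / 2, 0; Complex.I, -Complex.I / 2, 0; 0, 0, 1], ?_, ?_⟩⟩
    · simp [Matrix.det_fin_three]
      grind [Complex.I_ne_zero]
    · ext i j
      fin_cases i <;> fin_cases j <;> simp [Matrix.mul_apply, Fin.sum_univ_succ] <;>
        grind [Complex.I_mul_I]
  | gam => exact ⟨_, .oneGam, h⟩
  | hyp l hl => exact ⟨_, .oneHyp l hl, h⟩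

theorem exists_canonical₃ (A : Matrix (Fin 3) (Fin 3) ℂ) : ∃ B, Canonical₃ B ∧ Cong A B := by
  rcases exists_cong_normalized A with ⟨N, h⟩ | ⟨N, h⟩ | ⟨l, hl, s, q, p, N, h⟩
  · obtain ⟨B, hB, h'⟩ := exists_canonical₃_of_blk_zero N
    exact ⟨B, hB, h.trans h'⟩
  · obtain ⟨B, hB, h'⟩ := exists_canonical₃_of_blk_one N
    exact ⟨B, hB, h.trans h'⟩
  · rcases cong_fin_one N with hN | hN <;>
      obtain ⟨q, p, h'⟩ := cong_double_border l s q p hN <;>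
      replace h := h.trans h' <;> rw [blk_fin_two, blk_fin_one] at h <;>
      generalize q 0 = q at h <;> generalize p 0 = p at h <;>
      simp only [Matrix.of_apply, cons_val_zero, cons_val_one, Pi.zero_apply] at h
    · by_cases hp : p - l * q = 0
      · obtain ⟨B, hB, h'⟩ := exists_canonical₃_of_blk_zero !![0, l; 1, s]
        -- When p = lq, the vector e₃ - qe₁ is in the radical on both sides.
        refine ⟨B, hB, h.trans (.trans ⟨!![-q, 1, 0; 0, 0, 1; 1, 0, 0], ?_, ?_⟩ h')⟩
        · simp [Matrix.det_fin_three]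
        · rw [blk_fin_two]
          ext i j
          fin_cases i <;> fin_cases j <;> simp [Matrix.mul_apply, Fin.sum_univ_succ] <;> grind
      -- The columns are u = (e₃ - qe₁)/(p - lq), e₂ - su and e₁ - lu. Here b(u, e₂) = 1 and b(e₂,
      -- u) = 0, so the multiples of u cancel s and l.
      · refine ⟨_, .nil, h.trans ⟨!![-q / (p - l * q), s * q / (p - l * q), 1 + l * q / (p - l * q);
          0, 1, 0; 1 / (p - l * q), -s / (p - l * q), -l / (p - l * q)], ?_, ?_⟩⟩
        · simp [Matrix.det_fin_three]
          grind
        · ext i j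
          fin_cases i <;> fin_cases j <;> simp [Matrix.mul_apply, Fin.sum_univ_succ] <;> grind
    · by_cases hl1 : l = 1
      · subst hl1
        by_cases hp : p - q = 0
        · obtain ⟨B, hB, h'⟩ := exists_canonical₃_of_blk_one !![0, 1; 1, s - p ^ 2]
          refine ⟨B, hB, h.trans (.trans ⟨!![0, 1, 0; 0, 0, 1; 1, 0, -p], ?_, ?_⟩ h')⟩
          · simp [Matrix.det_fin_three]
          · rw [blk_fin_two]
            ext i j
            fin_cases i <;> fin_cases j <;> simp [Matrix.mul_apply, Fin.sum_univ_succ] <;> grind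
        -- The new basis is e₁/t, ie₃ and xe₁ + te₂ + be₃. The pairings of the last two must be -1
        -- and 1, that is tp + b = i and tq + b = -i, which fixes t and b. The coefficient x then
        -- makes the third vector isotropic.
        · obtain ⟨t, ht⟩ : ∃ t, t = 2 * Complex.I / (p - q) := ⟨_, rfl⟩
          have ht0 : t ≠ 0 := by simp [ht, hp]
          obtain ⟨b, hb⟩ : ∃ b, b = -Complex.I - t * q := ⟨_, rfl⟩
          refine ⟨_, .gam₃, h.trans ⟨!![1 / t, 0,
            -(t ^ 2 * s + t * b * (p + q) + b ^ 2) / (2 * t); 0, 0, t; 0, Complex.I, b], ?_, ?_⟩⟩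
          · simp [Matrix.det_fin_three]
            grind [Complex.I_ne_zero]
          · ext i j
            fin_cases i <;> fin_cases j <;> simp [Matrix.mul_apply, Fin.sum_univ_succ] <;>
              grind [Complex.I_mul_I]
      -- The constants make e₃ + ae₁ and e₂ + be₃ orthogonal in both orders: al + p + b = 0 and a +
      -- q + b = 0.
      · obtain ⟨a, ha⟩ : ∃ a, a * (l - 1) = q - p :=
          ⟨(q - p) / (l - 1), div_mul_cancel₀ _ (sub_ne_zero.2 hl1)⟩
        obtain ⟨b, hb⟩ : ∃ b, b = - q - a := ⟨_, rfl⟩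
        obtain ⟨B, hB, h'⟩ := exists_canonical₃_of_blk_one !![0, l; 1, s + b * (p + q) + b ^ 2]
        refine ⟨B, hB, h.trans (.trans ⟨!![a, 1, 0; 0, 0, 1; 1, 0, b], ?_, ?_⟩ h')⟩
        · simp [Matrix.det_fin_three]
        · rw [blk_fin_two]
          ext i j
          fin_cases i <;> fin_cases j <;> simp [Matrix.mul_apply, Fin.sum_univ_succ] <;> grind

/-! ### Canonical forms in dimension four -/

/-- The table of an admissible label, or the zero matrix. -/
def Canonical₄ (B : Matrix (Fin 4) (Fin 4) ℂ) : Prop :=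
  B = 0 ∨ ∃ L : Label, L.Admissible ∧ B = L.table

/-- The orthogonal direct sum of two forms on spaces of dimension two. -/
def dsum (A B : Matrix (Fin 2) (Fin 2) ℂ) : Matrix (Fin 4) (Fin 4) ℂ :=
  !![A 0 0, A 0 1, 0, 0; A 1 0, A 1 1, 0, 0; 0, 0, B 0 0, B 0 1; 0, 0, B 1 0, B 1 1]

theorem det_fin_four (A : Matrix (Fin 4) (Fin 4) ℂ) : A.det =
    A 0 0 * (A 1 1 * (A 2 2 * A 3 3 - A 2 3 * A 3 2) - A 1 2 * (A 2 1 * A 3 3 - A 2 3 * A 3 1)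
      + A 1 3 * (A 2 1 * A 3 2 - A 2 2 * A 3 1))
    - A 0 1 * (A 1 0 * (A 2 2 * A 3 3 - A 2 3 * A 3 2) - A 1 2 * (A 2 0 * A 3 3 - A 2 3 * A 3 0)
      + A 1 3 * (A 2 0 * A 3 2 - A 2 2 * A 3 0))
    + A 0 2 * (A 1 0 * (A 2 1 * A 3 3 - A 2 3 * A 3 1) - A 1 1 * (A 2 0 * A 3 3 - A 2 3 * A 3 0)
      + A 1 3 * (A 2 0 * A 3 1 - A 2 1 * A 3 0))
    - A 0 3 * (A 1 0 * (A 2 1 * A 3 2 - A 2 2 * A 3 1) - A 1 1 * (A 2 0 * A 3 2 - A 2 2 * A 3 0)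
      + A 1 2 * (A 2 0 * A 3 1 - A 2 1 * A 3 0)) := by
  have h (j : Fin 4) : A.submatrix Fin.succ j.succAbove =
      !![A 1 (j.succAbove 0), A 1 (j.succAbove 1), A 1 (j.succAbove 2);
        A 2 (j.succAbove 0), A 2 (j.succAbove 1), A 2 (j.succAbove 2);
        A 3 (j.succAbove 0), A 3 (j.succAbove 1), A 3 (j.succAbove 2)] := by
    ext i k
    fin_cases i <;> fin_cases k <;> rfl
  have h0 : Fin.succAbove (0 : Fin 4) = ![1, 2, 3] := by decide
  have h1 : Fin.succAbove (1 : Fin 4) = ![0, 2, 3] := by decide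
  have h2 : Fin.succAbove (2 : Fin 4) = ![0, 1, 3] := by decide
  have h3 : Fin.succAbove (3 : Fin 4) = ![0, 1, 2] := by decide
  rw [Matrix.det_succ_row_zero]
  simp only [h, Fin.sum_univ_four, h0, h1, h2, h3]
  simp [Matrix.det_fin_three]
  ring

theorem dsum_of (a b c d a' b' c' d' : ℂ) : dsum !![a, b; c, d] !![a', b'; c', d'] =
    !![a, b, 0, 0; c, d, 0, 0; 0, 0, a', b'; 0, 0, c', d'] := rfl

theorem cong_dsum_one (a b c d : ℂ) : Cong (dsum !![1, 0; 0, 0] !![a, b; c, d])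
    !![1, 0, 0, 0; 0, a, b, 0; 0, c, d, 0; 0, 0, 0, 0] := by
  refine .of_submatrix ⟨![0, 2, 3, 1], ![0, 3, 1, 2], by decide, by decide⟩ ?_
  ext i j
  fin_cases i <;> fin_cases j <;> simp [dsum]

theorem dsum_comm (A B : Matrix (Fin 2) (Fin 2) ℂ) : Cong (dsum A B) (dsum B A) := by
  refine .of_submatrix (finRotate 4 * finRotate 4) ?_
  ext i j
  fin_cases i <;> fin_cases j <;> rfl

theorem Cong.dsum_right (A : Matrix (Fin 2) (Fin 2) ℂ) {B C : Matrix (Fin 2) (Fin 2) ℂ}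
    (h : Cong B C) : Cong (dsum A B) (dsum A C) := by
  obtain ⟨P, hP, rfl⟩ := h
  refine ⟨dsum 1 P, ?_, ?_⟩
  · rw [Matrix.det_fin_two] at hP
    simpa [det_fin_four, dsum] using hP
  · ext i j
    fin_cases i <;> fin_cases j <;>
      simp [Matrix.mul_apply, Fin.sum_univ_four, Fin.sum_univ_two, dsum]

theorem Cong.dsum {A B C D : Matrix (Fin 2) (Fin 2) ℂ} (h : Cong A B) (h' : Cong C D) :
    Cong (dsum A C) (dsum B D) :=
  (h'.dsum_right A).trans ((dsum_comm _ _).trans ((h.dsum_right D).trans (dsum_comm _ _)))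

theorem mem_halfPlane_or_neg (x : ℂ) : x ∈ halfPlane ∨ -x ∈ halfPlane := by
  simp only [halfPlane, Set.mem_union, Set.mem_ofPred_eq, Complex.neg_re, Complex.neg_im]
  grind

theorem exists_canonical₄_of_hyp_hyp {l m : ℂ} (hl : l ∈ unitDiscHalf) (hm : m ∈ unitDiscHalf) :
    ∃ B, Canonical₄ B ∧ Cong (dsum !![0, 1; l, 0] !![0, 1; m, 0]) B := by
  rcases mem_halfPlane_or_neg (m - l) with h | h
  · exact ⟨_, .inr ⟨.h13 m l, ⟨hm, hl, h⟩, rfl⟩, .of_eq rfl⟩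
  · rw [neg_sub] at h
    exact ⟨_, .inr ⟨.h13 l m, ⟨hl, hm, h⟩, rfl⟩, dsum_comm _ _⟩

theorem cong_one_one_hyp :
    Cong !![1, 0; 0, 1] !![0, 1; 1, 0] := by
  refine ⟨!![1, 1 / 2; Complex.I, -Complex.I / 2], ?_, ?_⟩
  · simp [Matrix.det_fin_two]
    grind [Complex.I_ne_zero]
  · ext i j
    fin_cases i <;> fin_cases j <;> simp [Matrix.mul_apply, Fin.sum_univ_succ] <;>
      grind [Complex.I_mul_I]

/-- Every unordered pair of two-dimensional canonical forms occurs in the table. Two squares merge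
into a hyperbolic plane with parameter 1, and two hyperbolic planes are ordered by `halfPlane`. -/
theorem exists_canonical₄_of_dsum (N N' : Matrix (Fin 2) (Fin 2) ℂ) :
    ∃ B, Canonical₄ B ∧ Cong (dsum N N') B := by
  obtain ⟨A, hA, h⟩ := exists_canonical₂ N
  obtain ⟨A', hA', h'⟩ := exists_canonical₂ N'
  suffices H : ∃ B, Canonical₄ B ∧ (Cong (dsum A A') B ∨ Cong (dsum A' A) B) by
    obtain ⟨B, hB, H | H⟩ := H
    · exact ⟨B, hB, (h.dsum h').trans H⟩
    · exact ⟨B, hB, (h.dsum h').trans ((dsum_comm _ _).trans H)⟩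
  cases hA with
  | zero => cases hA' with
    | zero =>
      refine ⟨_, .inl rfl, .inl (.of_eq ?_)⟩
      ext i j
      fin_cases i <;> fin_cases j <;> rfl
    | one => exact ⟨_, .inr ⟨.h01, trivial, rfl⟩, .inr (.of_eq (dsum_of ..))⟩
    | gam => exact ⟨_, .inr ⟨.h02, trivial, rfl⟩, .inr (.of_eq (dsum_of ..))⟩
    | hyp l hl => exact ⟨_, .inr ⟨.h03 l, hl, rfl⟩, .inr (.of_eq (dsum_of ..))⟩
  | one => cases hA' with
    | zero => exact ⟨_, .inr ⟨.h01, trivial, rfl⟩, .inl (.of_eq (dsum_of ..))⟩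
    | one =>
      refine ⟨_, .inr ⟨.h03 1, one_mem_unitDiscHalf, rfl⟩, .inl ((cong_dsum_one ..).trans
        (.trans (.of_eq (dsum_of ..).symm) ((cong_one_one_hyp.dsum (.refl !![0, 0; 0, 0])).trans
          (.of_eq (dsum_of ..)))))⟩
    | gam => exact ⟨_, .inr ⟨.h04, trivial, rfl⟩, .inl (cong_dsum_one ..)⟩
    | hyp l hl => exact ⟨_, .inr ⟨.h05 l, hl, rfl⟩, .inl (cong_dsum_one ..)⟩
  | gam => cases hA' with
    | zero => exact ⟨_, .inr ⟨.h02, trivial, rfl⟩, .inl (.of_eq (dsum_of ..))⟩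
    | one => exact ⟨_, .inr ⟨.h04, trivial, rfl⟩, .inr (cong_dsum_one ..)⟩
    | gam => exact ⟨_, .inr ⟨.h12, trivial, rfl⟩, .inl (.of_eq (dsum_of ..))⟩
    | hyp l hl => exact ⟨_, .inr ⟨.h14 l, hl, rfl⟩, .inr (.of_eq (dsum_of ..))⟩
  | hyp l hl => cases hA' with
    | zero => exact ⟨_, .inr ⟨.h03 l, hl, rfl⟩, .inl (.of_eq (dsum_of ..))⟩
    | one => exact ⟨_, .inr ⟨.h05 l, hl, rfl⟩, .inr (cong_dsum_one ..)⟩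
    | gam => exact ⟨_, .inr ⟨.h14 l, hl, rfl⟩, .inl (.of_eq (dsum_of ..))⟩
    | hyp m hm =>
      obtain ⟨B, hB, H⟩ := exists_canonical₄_of_hyp_hyp hl hm
      exact ⟨B, hB, .inl H⟩

theorem exists_canonical₄_of_blk_zero (N : Matrix (Fin 3) (Fin 3) ℂ) :
    ∃ B, Canonical₄ B ∧ Cong (blk 0 0 0 N) B := by
  obtain ⟨B, hB, h⟩ := exists_canonical₃ N
  replace h := (h.blk 0).trans (.submatrix _ (finRotate 4))
  rw [blk_fin_three 0 _ _ B] at h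
  suffices H : ∃ C, Canonical₄ C ∧ !![B 0 0, B 0 1, B 0 2, 0; B 1 0, B 1 1, B 1 2, 0;
      B 2 0, B 2 1, B 2 2, 0; 0, 0, 0, 0] = C by
    obtain ⟨C, hC, H⟩ := H
    refine ⟨C, hC, h.trans (.of_eq ?_)⟩
    rw [← H]
    ext i j
    fin_cases i <;> fin_cases j <;> rfl
  cases hB with
  | zero =>
    refine ⟨_, .inl rfl, ?_⟩
    ext i j
    fin_cases i <;> fin_cases j <;> rfl
  | one => exact ⟨_, .inr ⟨.h01, trivial, rfl⟩, rfl⟩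
  | gam => exact ⟨_, .inr ⟨.h02, trivial, rfl⟩, rfl⟩
  | hyp l hl => exact ⟨_, .inr ⟨.h03 l, hl, rfl⟩, rfl⟩
  | oneGam => exact ⟨_, .inr ⟨.h04, trivial, rfl⟩, rfl⟩
  | oneHyp l hl => exact ⟨_, .inr ⟨.h05 l, hl, rfl⟩, rfl⟩
  | nil => exact ⟨_, .inr ⟨.h06, trivial, rfl⟩, rfl⟩
  | gam₃ => exact ⟨_, .inr ⟨.h07, trivial, rfl⟩, rfl⟩

theorem exists_canonical₄_of_blk_one (N : Matrix (Fin 3) (Fin 3) ℂ) :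
    ∃ B, Canonical₄ B ∧ Cong (blk 1 0 0 N) B := by
  obtain ⟨B, hB, h⟩ := exists_canonical₃ N
  replace h := h.blk 1
  rw [blk_fin_three 1 _ _ B] at h
  suffices H : ∃ C, Canonical₄ C ∧ Cong !![1, 0, 0, 0; 0, B 0 0, B 0 1, B 0 2;
      0, B 1 0, B 1 1, B 1 2; 0, B 2 0, B 2 1, B 2 2] C by
    obtain ⟨C, hC, H⟩ := H
    exact ⟨C, hC, h.trans H⟩
  cases hB with
  | zero => exact ⟨_, .inr ⟨.h01, trivial, rfl⟩, .of_eq rfl⟩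
  -- When the three-dimensional form also begins with a square, the two squares are grouped into a
  -- plane, and the matrix is a sum of two planes.
  | one => exact exists_canonical₄_of_dsum !![1, 0; 0, 1] !![0, 0; 0, 0]
  | gam => exact ⟨_, .inr ⟨.h04, trivial, rfl⟩, .of_eq rfl⟩
  | hyp l hl => exact ⟨_, .inr ⟨.h05 l, hl, rfl⟩, .of_eq rfl⟩
  | oneGam => exact exists_canonical₄_of_dsum !![1, 0; 0, 1] !![0, -1; 1, 1]
  | oneHyp l hl => exact exists_canonical₄_of_dsum !![1, 0; 0, 1] !![0, 1; l, 0]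
  | nil => exact ⟨_, .inr ⟨.h10, trivial, rfl⟩, .of_eq rfl⟩
  | gam₃ => exact ⟨_, .inr ⟨.h11, trivial, rfl⟩, .of_eq rfl⟩

/-- Both norms must be 1, so y is the conjugate of x, and nonnegative imaginary parts make x real.
-/
theorem eq_of_mul_eq_one_of_mem_unitDiscHalf {x y : ℂ} (hx : x ∈ unitDiscHalf)
    (hy : y ∈ unitDiscHalf) (h : x * y = 1) : x = y := by
  have hn : ‖x‖ * ‖y‖ = 1 := by rw [← norm_mul, h, norm_one]
  have hx1 : ‖x‖ ≤ 1 := by rcases hx with hx | hx; exacts [le_of_lt hx, hx.1.le]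
  have hy1 : ‖y‖ ≤ 1 := by rcases hy with hy | hy; exacts [le_of_lt hy, hy.1.le]
  have hx2 : ‖x‖ = 1 := by nlinarith [norm_nonneg x, norm_nonneg y]
  have hy2 : ‖y‖ = 1 := by rw [hx2] at hn; linarith
  have hxi : 0 ≤ x.im := by
    rcases hx with hx | hx
    · exact absurd hx2 (ne_of_lt hx)
    · exact hx.2
  have hyi : 0 ≤ y.im := by
    rcases hy with hy | hy
    · exact absurd hy2 (ne_of_lt hy)
    · exact hy.2
  have hy3 : y = (starRingEnd ℂ) x := by
    rw [← Complex.inv_eq_conj hx2]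
    exact eq_inv_of_mul_eq_one_right h
  have h0 : x.im = 0 := by
    rw [hy3, Complex.conj_im] at hyi
    linarith
  rw [hy3]
  exact (Complex.conj_eq_iff_im.2 h0).symm

/-- Some nonzero combination of e₃ and e₄ pairs to zero with e₂ and hence lies in the radical; the
rest has dimension three. -/
theorem exists_canonical₄_of_border_zero (l s p₁ p₂ : ℂ) : ∃ B, Canonical₄ B ∧
    Cong !![0, l, 0, 0; 1, s, 0, 0; 0, p₁, 0, 0; 0, p₂, 0, 0] B := by
  by_cases h2 : p₂ = 0
  · subst h2
    obtain ⟨B, hB, h⟩ := exists_canonical₄_of_blk_zero !![0, l, 0; 1, s, 0; 0, p₁, 0]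
    refine ⟨B, hB, .trans ⟨!![0, 1, 0, 0; 0, 0, 1, 0; 0, 0, 0, 1; 1, 0, 0, 0], ?_, ?_⟩ h⟩
    · simp [det_fin_four]
    · rw [blk_fin_three]
      ext i j
      fin_cases i <;> fin_cases j <;> simp [Matrix.mul_apply, Fin.sum_univ_four]
  · obtain ⟨B, hB, h⟩ := exists_canonical₄_of_blk_zero !![0, l, 0; 1, s, 0; 0, p₂, 0]
    refine ⟨B, hB, .trans ⟨!![0, 1, 0, 0; 0, 0, 1, 0; 1, 0, 0, 0; -p₁ / p₂, 0, 0, 1], ?_, ?_⟩ h⟩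
    · simp [det_fin_four]
    · rw [blk_fin_three]
      ext i j
      fin_cases i <;> fin_cases j <;> simp [Matrix.mul_apply, Fin.sum_univ_four] <;> grind

theorem exists_canonical₄_of_border_one (l s p₁ p₂ : ℂ) : ∃ B, Canonical₄ B ∧
    Cong !![0, l, 0, 0; 1, s, 0, 0; 0, p₁, 1, 0; 0, p₂, 0, 0] B := by
  by_cases h2 : p₂ = 0
  · subst h2
    obtain ⟨B, hB, h⟩ := exists_canonical₄_of_blk_zero !![0, l, 0; 1, s, 0; 0, p₁, 1]
    refine ⟨B, hB, .trans ⟨!![0, 1, 0, 0; 0, 0, 1, 0; 0, 0, 0, 1; 1, 0, 0, 0], ?_, ?_⟩ h⟩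
    · simp [det_fin_four]
    · rw [blk_fin_three]
      ext i j
      fin_cases i <;> fin_cases j <;> simp [Matrix.mul_apply, Fin.sum_univ_four]
  -- The vector e₃ - (p₁/p₂)e₄ has square 1 and is orthogonal to e₁, e₂ and e₄ on both sides, so it
  -- splits off.
  · obtain ⟨B, hB, h⟩ := exists_canonical₄_of_blk_one !![0, l, 0; 1, s, 0; 0, p₂, 0]
    refine ⟨B, hB, .trans ⟨!![0, 1, 0, 0; 0, 0, 1, 0; 1, 0, 0, 0; -p₁ / p₂, 0, 0, 1], ?_, ?_⟩ h⟩
    · simp [det_fin_four]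
    · rw [blk_fin_three]
      ext i j
      fin_cases i <;> fin_cases j <;> simp [Matrix.mul_apply, Fin.sum_univ_four] <;> grind

/-- The surviving coupling p joins the two planes into one indecomposable form: a chain for l = 0,
and the `h09` family otherwise. Only s still has to be removed, by adding a multiple of e₁ to e₂. -/
theorem exists_canonical₄_of_border_hyp_same {l : ℂ} (hl : l ∈ unitDiscHalf) (hl1 : l ≠ -1)
    (s p : ℂ) (hp : p ≠ 0) : ∃ B, Canonical₄ B ∧
    Cong !![0, l, 0, 0; 1, s, 0, 0; 0, 0, 0, 1; 0, p, l, 0] B := by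
  have hl2 : 1 + l ≠ 0 := fun h => hl1 (by linear_combination h)
  obtain ⟨e, he⟩ : ∃ e, s + e * (1 + l) = 0 := ⟨-s / (1 + l), by field_simp; ring⟩
  by_cases hl0 : l = 0
  · subst hl0
    refine ⟨_, .inr ⟨.h15, trivial, rfl⟩,
      !![0, 0, e, 1; 0, 0, 1, 0; p, 0, 0, 0; 0, p⁻¹, 0, 0], ?_, ?_⟩
    · simp [det_fin_four, hp]
    · ext i j
      fin_cases i <;> fin_cases j <;>
        simp [Matrix.mul_apply, Fin.sum_univ_four, Label.table] <;> grind
  · refine ⟨_, .inr ⟨.h09 l, ⟨hl, hl1, hl0⟩, rfl⟩,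
      !![0, e, 0, 1; 0, 1, 0, 0; p, 0, 0, 0; 0, 0, p⁻¹, 0], ?_, ?_⟩
    · simp [det_fin_four, hp]
    · ext i j
      fin_cases i <;> fin_cases j <;>
        simp [Matrix.mul_apply, Fin.sum_univ_four, Label.table] <;> grind

/-- Replacing e₂ by e₂ + b₁e₃ + b₂e₄ and correcting e₃, e₄ by multiples of e₁ changes p₁ by (1 -
lm)b₂ and p₂ by (m - l)b₁. Thus p₁ is obstructed only for lm = 1 and p₂ only for l = m. -/
theorem exists_canonical₄_of_border_hyp_generic (l m s p₁ p₂ b₁ b₂ : ℂ)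
    (h1 : p₁ + (1 - l * m) * b₂ = 0) (h2 : p₂ + (m - l) * b₁ = 0) : ∃ B, Canonical₄ B ∧
    Cong !![0, l, 0, 0; 1, s, 0, 0; 0, p₁, 0, 1; 0, p₂, m, 0] B := by
  obtain ⟨B, hB, h⟩ := exists_canonical₄_of_dsum
    !![0, l; 1, s + p₁ * b₁ + p₂ * b₂ + (1 + m) * b₁ * b₂] !![0, 1; m, 0]
  refine ⟨B, hB, .trans
    ⟨!![1, 0, -(m * b₂), -b₁; 0, 1, 0, 0; 0, b₁, 1, 0; 0, b₂, 0, 1], ?_, ?_⟩ h⟩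
  · simp [det_fin_four]
  · rw [dsum_of]
    ext i j
    fin_cases i <;> fin_cases j <;> simp [Matrix.mul_apply, Fin.sum_univ_four] <;> grind

theorem exists_canonical₄_of_border_hyp_eq {l : ℂ} (hl : l ∈ unitDiscHalf) (h1 : l * l ≠ 1)
    (s p₁ p₂ : ℂ) : ∃ B, Canonical₄ B ∧
    Cong !![0, l, 0, 0; 1, s, 0, 0; 0, p₁, 0, 1; 0, p₂, l, 0] B := by
  obtain ⟨b, hb⟩ : ∃ b, p₁ + (1 - l * l) * b = 0 :=
    ⟨p₁ / (l * l - 1), by have := sub_ne_zero.2 h1; grind⟩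
  by_cases h2 : p₂ = 0
  · exact exists_canonical₄_of_border_hyp_generic l l s p₁ p₂ 0 b hb (by simp [h2])
  · obtain ⟨B, hB, h⟩ := exists_canonical₄_of_border_hyp_same hl (by rintro rfl; simp at h1)
      (s + p₂ * b) p₂ h2
    refine ⟨B, hB, .trans
      ⟨!![1, 0, -(l * b), 0; 0, 1, 0, 0; 0, 0, 1, 0; 0, b, 0, 1], ?_, ?_⟩ h⟩
    · simp [det_fin_four]
    · ext i j
      fin_cases i <;> fin_cases j <;> simp [Matrix.mul_apply, Fin.sum_univ_four] <;> grind

theorem exists_canonical₄_of_border_hyp_one (s p₁ p₂ : ℂ) : ∃ B, Canonical₄ B ∧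
    Cong !![0, 1, 0, 0; 1, s, 0, 0; 0, p₁, 0, 1; 0, p₂, 1, 0] B := by
  by_cases h1 : p₁ = 0 <;> by_cases h2 : p₂ = 0
  · exact exists_canonical₄_of_border_hyp_generic 1 1 s p₁ p₂ 0 0 (by simp [h1]) (by simp [h2])
  · subst h1
    exact exists_canonical₄_of_border_hyp_same one_mem_unitDiscHalf (by norm_num) s p₂ h2
  · subst h2
    obtain ⟨B, hB, h⟩ := exists_canonical₄_of_border_hyp_same one_mem_unitDiscHalf
      (by norm_num) s p₁ h1
    refine ⟨B, hB, .trans (.of_submatrix (Equiv.swap 2 3) ?_) h⟩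
    ext i j
    fin_cases i <;> fin_cases j <;> simp [Equiv.swap_apply_def]
  -- The vector p₂e₃ - p₁e₄ does not pair with e₂ and has square -2p₁p₂. Scaled by c it splits off
  -- as a square, with p₂e₃ + p₁e₄ orthogonal to it.
  · obtain ⟨c, hc⟩ := IsAlgClosed.exists_pow_nat_eq (-(2 * p₁ * p₂))⁻¹ (n := 2) two_pos
    have hd : -(2 * p₁ * p₂) ≠ 0 := by simp [h1, h2]
    have hc' : c ^ 2 * -(2 * p₁ * p₂) = 1 := by rw [hc, inv_mul_cancel₀ hd]
    have hc0 : c ≠ 0 := by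
      rintro rfl
      simp at hc'
    obtain ⟨B, hB, h⟩ := exists_canonical₄_of_blk_one
      !![0, 1, 0; 1, s, 0; 0, 2 * p₁ * p₂, 2 * p₁ * p₂]
    refine ⟨B, hB, .trans ⟨!![0, 1, 0, 0; 0, 0, 1, 0; c * p₂, 0, 0, p₂; -c * p₁, 0, 0, p₁],
      ?_, ?_⟩ h⟩
    · simp [det_fin_four]
      grind
    · rw [blk_fin_three]
      ext i j
      fin_cases i <;> fin_cases j <;> simp [Matrix.mul_apply, Fin.sum_univ_four] <;> grind

theorem exists_canonical₄_of_border_alternating (s : ℂ) : ∃ B, Canonical₄ B ∧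
    Cong !![0, -1, 0, 0; 1, s, 0, 0; 0, 0, 0, 1; 0, 1, -1, 0] B := by
  -- The symmetric part of the form has radical ⟨e₁, e₃⟩, which is Lagrangian for the alternating
  -- part. Columns two and four are orthonormal for the symmetric part and, thanks to their
  -- e₁-components, isotropic for the alternating part. Columns one and three are the matching dual
  -- basis of the radical.
  refine ⟨_, .inr ⟨.h12, trivial, rfl⟩,
    !![(1 + s) / 2, 1 / 2, Complex.I * (1 - s) / 2, Complex.I / 2;
      0, 1, 0, -Complex.I; -1 / 2, 0, Complex.I / 2, 0;
      0, 1 - s, 0, Complex.I * (1 + s)], ?_, ?_⟩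
  · simp [det_fin_four]
    grind [Complex.I_mul_I]
  · ext i j
    fin_cases i <;> fin_cases j <;>
      simp [Matrix.mul_apply, Fin.sum_univ_four, Label.table] <;> grind [Complex.I_mul_I]

/-- Every element of SL₂ preserves the alternating plane ⟨e₃, e₄⟩, so any nonzero (p₁, p₂) can be
moved to (0, 1). -/
theorem exists_canonical₄_of_border_hyp_neg_one (s p₁ p₂ : ℂ) : ∃ B, Canonical₄ B ∧
    Cong !![0, -1, 0, 0; 1, s, 0, 0; 0, p₁, 0, 1; 0, p₂, -1, 0] B := by
  obtain ⟨B, hB, h⟩ := exists_canonical₄_of_border_alternating s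
  by_cases h2 : p₂ = 0
  · by_cases h1 : p₁ = 0
    · exact exists_canonical₄_of_border_hyp_generic (-1) (-1) s p₁ p₂ 0 0 (by simp [h1])
        (by simp [h2])
    · refine ⟨B, hB, .trans
        ⟨!![1, 0, 0, 0; 0, 1, 0, 0; 0, 0, 0, p₁⁻¹; 0, 0, -p₁, 0], ?_, ?_⟩ h⟩
      · simp [det_fin_four, h1]
      · ext i j
        fin_cases i <;> fin_cases j <;> simp [Matrix.mul_apply, Fin.sum_univ_four, h1, h2]
  · refine ⟨B, hB, .trans
      ⟨!![1, 0, 0, 0; 0, 1, 0, 0; 0, 0, p₂, 0; 0, 0, -p₁, p₂⁻¹], ?_, ?_⟩ h⟩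
    · simp [det_fin_four, h2]
    · ext i j
      fin_cases i <;> fin_cases j <;> simp [Matrix.mul_apply, Fin.sum_univ_four] <;> grind

theorem exists_canonical₄_of_border_hyp {l m : ℂ} (hl : l ∈ unitDiscHalf)
    (hm : m ∈ unitDiscHalf) (s p₁ p₂ : ℂ) : ∃ B, Canonical₄ B ∧
    Cong !![0, l, 0, 0; 1, s, 0, 0; 0, p₁, 0, 1; 0, p₂, m, 0] B := by
  by_cases hlm : l = m
  · subst hlm
    by_cases h : l * l = 1
    · rcases mul_self_eq_one_iff.1 h with rfl | rfl
      · exact exists_canonical₄_of_border_hyp_one s p₁ p₂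
      · exact exists_canonical₄_of_border_hyp_neg_one s p₁ p₂
    · exact exists_canonical₄_of_border_hyp_eq hl h s p₁ p₂
  · have h1 : 1 - l * m ≠ 0 := fun h =>
      hlm (eq_of_mul_eq_one_of_mem_unitDiscHalf hl hm (by linear_combination -h))
    have h2 : m - l ≠ 0 := sub_ne_zero.2 (Ne.symm hlm)
    refine exists_canonical₄_of_border_hyp_generic l m s p₁ p₂ (-p₂ / (m - l))
      (-p₁ / (1 - l * m)) ?_ ?_ <;> field_simp <;> ring

theorem exists_canonical₄_of_border_gam_split (l s p₁ p₂ b₁ b₂ : ℂ)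
    (h1 : p₁ - (1 + l) * b₂ = 0) (h2 : p₂ + (1 + l) * b₁ + (1 - l) * b₂ = 0) :
    ∃ B, Canonical₄ B ∧
    Cong !![0, l, 0, 0; 1, s, 0, 0; 0, p₁, 0, -1; 0, p₂, 1, 1] B := by
  obtain ⟨B, hB, h⟩ := exists_canonical₄_of_dsum
    !![0, l; 1, s + p₁ * b₁ + p₂ * b₂ + b₂ ^ 2] !![0, -1; 1, 1]
  refine ⟨B, hB, .trans
    ⟨!![1, 0, -b₂, b₁ - b₂; 0, 1, 0, 0; 0, b₁, 1, 0; 0, b₂, 0, 1], ?_, ?_⟩ h⟩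
  · simp [det_fin_four]
  · rw [dsum_of]
    ext i j
    fin_cases i <;> fin_cases j <;> simp [Matrix.mul_apply, Fin.sum_univ_four] <;> grind

theorem exists_canonical₄_of_border_gam_neg_one (s p₁ p₂ : ℂ) (hp : p₁ ≠ 0) :
    ∃ B, Canonical₄ B ∧
    Cong !![0, -1, 0, 0; 1, s, 0, 0; 0, p₁, 0, -1; 0, p₂, 1, 1] B := by
  -- The last new vector is t(e₂ + ae₃ + be₄): b makes it orthogonal to the third column, a makes it
  -- isotropic, and t normalizes its pairing with the second column to 1.
  obtain ⟨b, hb⟩ : ∃ b, b = -p₂ / 2 := ⟨_, rfl⟩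
  obtain ⟨a, ha⟩ : ∃ a, a * p₁ = -(s + p₂ * b + b ^ 2) := ⟨_, div_mul_cancel₀ _ hp⟩
  obtain ⟨t, ht⟩ : ∃ t, t * p₁ = -2 * Complex.I := ⟨_, div_mul_cancel₀ _ hp⟩
  have ht0 : t ≠ 0 := by
    rintro rfl
    simp at ht
  refine ⟨_, .inr ⟨.h08, trivial, rfl⟩,
    !![t⁻¹, Complex.I * (p₁ / 2 - b), Complex.I * (a - b), 0; 0, 0, 0, t;
      0, Complex.I, 0, t * a; 0, 0, Complex.I, t * b], ?_, ?_⟩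
  · simp [det_fin_four, ht0]
  · ext i j
    fin_cases i <;> fin_cases j <;>
      simp [Matrix.mul_apply, Fin.sum_univ_four, Label.table] <;> grind [Complex.I_mul_I]

theorem exists_canonical₄_of_border_gam (l s p₁ p₂ : ℂ) : ∃ B, Canonical₄ B ∧
    Cong !![0, l, 0, 0; 1, s, 0, 0; 0, p₁, 0, -1; 0, p₂, 1, 1] B := by
  by_cases hl : l = -1
  · subst hl
    by_cases hp : p₁ = 0
    · exact exists_canonical₄_of_border_gam_split (-1) s p₁ p₂ 0 (-p₂ / 2) (by simp [hp])
        (by ring)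
    · exact exists_canonical₄_of_border_gam_neg_one s p₁ p₂ hp
  · have hl2 : 1 + l ≠ 0 := fun h => hl (by linear_combination h)
    refine exists_canonical₄_of_border_gam_split l s p₁ p₂
      (-(p₂ + (1 - l) * (p₁ / (1 + l))) / (1 + l)) (p₁ / (1 + l)) ?_ ?_ <;> field_simp <;> ring

theorem exists_canonical₄_of_border {l : ℂ} (hl : l ∈ unitDiscHalf) (s q₁ q₂ p₁ p₂ : ℂ)
    {C : Matrix (Fin 2) (Fin 2) ℂ} (hC : Canonical₂ C) : ∃ B, Canonical₄ B ∧
    Cong !![0, l, 0, 0; 1, s, q₁, q₂; 0, p₁, C 0 0, C 0 1; 0, p₂, C 1 0, C 1 1] B := by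
  -- Since b(e₂, e₁) = 1, subtracting multiples of e₁ from e₃ and e₄ always clears the row entries,
  -- at the cost of replacing pᵢ by pᵢ - lqᵢ.
  suffices H : ∃ B, Canonical₄ B ∧ Cong !![0, l, 0, 0; 1, s, 0, 0;
      0, p₁ - l * q₁, C 0 0, C 0 1; 0, p₂ - l * q₂, C 1 0, C 1 1] B by
    obtain ⟨B, hB, h⟩ := H
    refine ⟨B, hB, .trans
      ⟨!![1, 0, -q₁, -q₂; 0, 1, 0, 0; 0, 0, 1, 0; 0, 0, 0, 1], ?_, ?_⟩ h⟩
    · simp [det_fin_four]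
    · ext i j
      fin_cases i <;> fin_cases j <;> simp [Matrix.mul_apply, Fin.sum_univ_four] <;> ring
  cases hC with
  | zero => exact exists_canonical₄_of_border_zero ..
  | one => exact exists_canonical₄_of_border_one ..
  | gam => exact exists_canonical₄_of_border_gam ..
  | hyp m hm => exact exists_canonical₄_of_border_hyp hl hm ..

/-- Classification of the bilinear forms on a complex space of dimension four. -/
theorem exists_canonical₄ (A : Matrix (Fin 4) (Fin 4) ℂ) : ∃ B, Canonical₄ B ∧ Cong A B := by
  rcases exists_cong_normalized A with ⟨N, h⟩ | ⟨N, h⟩ | ⟨l, hl, s, q, p, N, h⟩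
  · obtain ⟨B, hB, h'⟩ := exists_canonical₄_of_blk_zero N
    exact ⟨B, hB, h.trans h'⟩
  · obtain ⟨B, hB, h'⟩ := exists_canonical₄_of_blk_one N
    exact ⟨B, hB, h.trans h'⟩
  · obtain ⟨C, hC, hN⟩ := exists_canonical₂ N
    obtain ⟨q, p, h'⟩ := cong_double_border l s q p hN
    replace h := h.trans h'
    rw [blk_fin_three, blk_fin_two] at h
    obtain ⟨B, hB, h'⟩ := exists_canonical₄_of_border hl s (q 0) (q 1) (p 0) (p 1) hC
    exact ⟨B, hB, h.trans h'⟩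

/-! ### From algebras to bilinear forms -/

theorem mulOfMatrix_apply (A : Matrix (Fin 4) (Fin 4) ℂ) (x y : Fin 5 → ℂ) :
    mulOfMatrix A x y = (∑ i : Fin 4, ∑ j : Fin 4, x i.castSucc * A i j * y j.castSucc) •
      (Pi.single (Fin.last 4) 1 : Fin 5 → ℂ) := rfl

theorem mulOfMatrix_single_castSucc (A : Matrix (Fin 4) (Fin 4) ℂ) (i j : Fin 4) :
    mulOfMatrix A (Pi.single i.castSucc 1) (Pi.single j.castSucc 1) =
      A i j • (Pi.single (Fin.last 4) 1 : Fin 5 → ℂ) := by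
  rw [mulOfMatrix_apply]
  simp [Pi.single_apply]

theorem single_last_castSucc (i : Fin 4) :
    (Pi.single (Fin.last 4) 1 : Fin 5 → ℂ) i.castSucc = 0 :=
  Pi.single_eq_of_ne (Fin.castSucc_lt_last i).ne _

theorem mulOfMatrix_single_last_left (A : Matrix (Fin 4) (Fin 4) ℂ) (y : Fin 5 → ℂ) :
    mulOfMatrix A (Pi.single (Fin.last 4) 1) y = 0 := by
  rw [mulOfMatrix_apply]
  simp only [single_last_castSucc, zero_mul, Finset.sum_const_zero, zero_smul]

theorem mulOfMatrix_single_last_right (A : Matrix (Fin 4) (Fin 4) ℂ) (x : Fin 5 → ℂ) :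
    mulOfMatrix A x (Pi.single (Fin.last 4) 1) = 0 := by
  rw [mulOfMatrix_apply]
  simp only [single_last_castSucc, mul_zero, Finset.sum_const_zero, zero_smul]

theorem square_mulOfMatrix_le (A : Matrix (Fin 4) (Fin 4) ℂ) :
    square (mulOfMatrix A) ≤ Submodule.span ℂ {Pi.single (Fin.last 4) 1} :=
  Submodule.map₂_le.2 fun _ _ _ _ => Submodule.smul_mem _ _ (Submodule.mem_span_singleton_self _)

theorem isNCHeisenberg_mulOfMatrix (A : Matrix (Fin 4) (Fin 4) ℂ) :
    IsNCHeisenberg (mulOfMatrix A) where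
  rank_square_le := (rank_submodule_le_one_iff' _).2 ⟨_, square_mulOfMatrix_le A⟩
  annihilates := by
    rw [eq_bot_iff]
    refine sup_le (Submodule.map₂_le.2 fun x hx y _ => ?_) (Submodule.map₂_le.2 fun x _ y hy => ?_)
    · obtain ⟨c, rfl⟩ := Submodule.mem_span_singleton.1 (square_mulOfMatrix_le A hx)
      rw [map_smul, LinearMap.smul_apply, mulOfMatrix_single_last_left, smul_zero]
      exact zero_mem _
    · obtain ⟨c, rfl⟩ := Submodule.mem_span_singleton.1 (square_mulOfMatrix_le A hy)
      rw [map_smul, mulOfMatrix_single_last_right, smul_zero]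
      exact zero_mem _

theorem mulOfMatrix_zero : mulOfMatrix 0 = 0 := by
  ext x y
  simp [mulOfMatrix_apply]

theorem mulOfMatrix_ne_zero {A : Matrix (Fin 4) (Fin 4) ℂ} (hA : A ≠ 0) : mulOfMatrix A ≠ 0 := by
  intro h
  refine hA ?_
  ext i j
  have h1 := congrFun (mulOfMatrix_single_castSucc A i j) (Fin.last 4)
  simpa [h] using h1.symm

theorem Label.table_ne_zero (L : Label) : L.table ≠ 0 := by
  obtain ⟨i, j, h⟩ : ∃ i j, L.table i j ≠ 0 := by
    cases L
    case h01 | h04 | h05 | h10 | h11 => exact ⟨0, 0, one_ne_zero⟩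
    case h03 | h06 | h13 | h14 | h15 => exact ⟨0, 1, one_ne_zero⟩
    case h02 | h12 => exact ⟨1, 0, one_ne_zero⟩
    case h07 | h09 => exact ⟨0, 2, one_ne_zero⟩
    case h08 => exact ⟨1, 2, one_ne_zero⟩
  intro h0
  exact h (by rw [h0]; rfl)

section AlgIso

variable {V W X : Type*} [AddCommGroup V] [Module ℂ V] [AddCommGroup W] [Module ℂ W]
  [AddCommGroup X] [Module ℂ X] {m : V →ₗ[ℂ] V →ₗ[ℂ] V} {m' : W →ₗ[ℂ] W →ₗ[ℂ] W}
  {m'' : X →ₗ[ℂ] X →ₗ[ℂ] X}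

theorem AlgIso.symm (h : AlgIso m m') : AlgIso m' m := by
  obtain ⟨e, he⟩ := h
  refine ⟨e.symm, fun x y => ?_⟩
  rw [LinearEquiv.symm_apply_eq, he]
  simp

theorem AlgIso.trans (h : AlgIso m m') (h' : AlgIso m' m'') : AlgIso m m'' := by
  obtain ⟨e, he⟩ := h
  obtain ⟨f, hf⟩ := h'
  exact ⟨e.trans f, fun x y => by simp [he, hf]⟩

theorem AlgIso.finrank_derivations_eq (h : AlgIso m m') :
    Module.finrank ℂ (derivations m) = Module.finrank ℂ (derivations m') := by
  obtain ⟨e, he⟩ := h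
  have he' (x y : W) : e.symm (m' x y) = m (e.symm x) (e.symm y) := by
    rw [LinearEquiv.symm_apply_eq, he]
    simp
  have h1 : (derivations m).map (e.conj : Module.End ℂ V →ₗ[ℂ] Module.End ℂ W) =
      derivations m' := by
    ext D
    obtain ⟨D, rfl⟩ := e.conj.surjective D
    rw [Submodule.mem_map_equiv, LinearEquiv.symm_apply_apply]
    constructor
    · intro hD x y
      have := congrArg e (hD (e.symm x) (e.symm y))
      simpa [LinearEquiv.conj_apply, he, he'] using this
    · intro hD x y
      have := congrArg e.symm (hD (e x) (e y))
      simpa [LinearEquiv.conj_apply, he, he'] using this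
  rw [← h1]
  exact (LinearEquiv.finrank_eq (e.conj.submoduleMap (derivations m)))

end AlgIso

/-- As A ≠ 0, e₅ is a product up to a scalar, so the isomorphism preserves its line. The upper left
block P may be singular, since a vector of the radical can be sent to e₅; only c ≠ 0 is guaranteed.
-/
theorem exists_transpose_mul_mul_eq_smul {A B : Matrix (Fin 4) (Fin 4) ℂ} (hA : A ≠ 0)
    (h : AlgIso (mulOfMatrix A) (mulOfMatrix B)) :
    ∃ (P : Matrix (Fin 4) (Fin 4) ℂ) (c : ℂ), c ≠ 0 ∧ Pᵀ * B * P = c • A := by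
  obtain ⟨e, he⟩ := h
  set z : Fin 5 → ℂ := Pi.single (Fin.last 4) 1 with hz
  have key (i j : Fin 4) := he (Pi.single i.castSucc 1) (Pi.single j.castSucc 1)
  simp only [mulOfMatrix_single_castSucc, ← hz, map_smul] at key
  obtain ⟨c, hc⟩ : ∃ c, e z = c • z := by
    obtain ⟨i, j, hij⟩ : ∃ i j, A i j ≠ 0 := by
      by_contra! h
      exact hA (by ext i j; exact h i j)
    have h1 := key i j
    rw [mulOfMatrix_apply, ← hz] at h1
    exact ⟨(A i j)⁻¹ * _, by rw [mul_smul, ← h1, smul_smul, inv_mul_cancel₀ hij, one_smul]⟩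
  have hz0 : z ≠ 0 := by simp [hz]
  refine ⟨Matrix.of fun i j => e (Pi.single j.castSucc 1) i.castSucc, c, ?_, ?_⟩
  · rintro rfl
    exact hz0 (by simpa using hc)
  · ext i j
    have h1 := congrFun (key i j) (Fin.last 4)
    rw [hc, mulOfMatrix_apply] at h1
    simp only [hz, Pi.smul_apply, Pi.single_eq_same, smul_eq_mul, mul_one] at h1
    rw [Matrix.smul_apply, smul_eq_mul, mul_comm, h1]
    simp only [Matrix.mul_apply, Matrix.transpose_apply, Matrix.of_apply, Finset.sum_mul]
    rw [Finset.sum_comm]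

section Existence

variable {V : Type*} [AddCommGroup V] [Module ℂ V] {m : V →ₗ[ℂ] V →ₗ[ℂ] V}

theorem IsNCHeisenberg.exists_bilin (hm : IsNCHeisenberg m) (h0 : m ≠ 0) :
    ∃ (z : V) (b : V →ₗ[ℂ] V →ₗ[ℂ] ℂ), z ≠ 0 ∧ (∀ x y, m x y = b x y • z) ∧
      (∀ y, b z y = 0) ∧ ∀ x, b x z = 0 := by
  obtain ⟨z, hz, hs⟩ := (rank_submodule_le_one_iff _).1 hm.rank_square_le
  have hmem (x y : V) : m x y ∈ Submodule.span ℂ {z} :=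
    hs (Submodule.apply_mem_map₂ _ trivial trivial)
  have hz0 : z ≠ 0 := by
    rintro rfl
    refine h0 ?_
    ext x y
    simpa using hmem x y
  obtain ⟨f, hf⟩ : ∃ f : V →ₗ[ℂ] ℂ, f z = 1 := by
    obtain ⟨f, hf⟩ := not_forall.1 (mt (Module.forall_dual_apply_eq_zero_iff ℂ z).1 hz0)
    exact ⟨(f z)⁻¹ • f, by simp [hf]⟩
  have hb (x y : V) : m x y = f (m x y) • z := by
    obtain ⟨c, hc⟩ := Submodule.mem_span_singleton.1 (hmem x y)
    rw [← hc]
    simp [hf]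
  have hann := hm.annihilates
  rw [eq_bot_iff, sup_le_iff] at hann
  refine ⟨z, m.compr₂ f, hz0, hb, fun y => ?_, fun x => ?_⟩
  · have : m z y = 0 := by simpa using hann.1 (Submodule.apply_mem_map₂ _ hz trivial)
    simp [this]
  · have : m x z = 0 := by simpa using hann.2 (Submodule.apply_mem_map₂ _ trivial hz)
    simp [this]

/-- A is the matrix of the form on a complement of z. A congruence P changes the basis of that
complement and fixes z. -/
theorem IsNCHeisenberg.exists_algIso_of_cong (hV : Module.finrank ℂ V = 5)
    (hm : IsNCHeisenberg m) (h0 : m ≠ 0) :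
    ∃ A : Matrix (Fin 4) (Fin 4) ℂ, ∀ B, Cong A B → AlgIso m (mulOfMatrix B) := by
  obtain ⟨z, b, hz, hb, hzl, hzr⟩ := hm.exists_bilin h0
  have : FiniteDimensional ℂ V := Module.finite_of_finrank_eq_succ hV
  obtain ⟨U, hU⟩ := Submodule.exists_isCompl (Submodule.span ℂ {z})
  have hU4 : Module.finrank ℂ U = 4 := by
    have := Submodule.finrank_add_eq_of_isCompl hU
    rw [finrank_span_singleton hz, hV] at this
    omega
  let u : (Fin 4 → ℂ) ≃ₗ[ℂ] U := (LinearEquiv.ofFinrankEq _ _ (by simp [hU4]))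
  let g : (Fin 4 → ℂ) →ₗ[ℂ] V := U.subtype ∘ₗ u.toLinearMap
  refine ⟨LinearMap.toMatrix₂' ℂ (b.compl₁₂ g g), ?_⟩
  rintro B ⟨P, hP, hPB⟩
  let f : (Fin 5 → ℂ) →ₗ[ℂ] V :=
    g ∘ₗ Matrix.toLin' P ∘ₗ LinearMap.funLeft ℂ ℂ Fin.castSucc +
      (LinearMap.proj (Fin.last 4)).smulRight z
  have hf (x : Fin 5 → ℂ) : f x = g (P *ᵥ fun i => x i.castSucc) + x (Fin.last 4) • z := rfl
  have hinj : Function.Injective f := by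
    rw [← LinearMap.ker_eq_bot, LinearMap.ker_eq_bot']
    intro x hx
    rw [hf] at hx
    have h1 : g (P *ᵥ fun i => x i.castSucc) ∈ U := (u _).2
    have h2 : x (Fin.last 4) • z ∈ Submodule.span ℂ {z} :=
      Submodule.smul_mem _ _ (Submodule.mem_span_singleton_self z)
    have h3 : x (Fin.last 4) • z ∈ U := by
      rw [eq_neg_of_add_eq_zero_right hx]
      exact U.neg_mem h1
    have h4 : x (Fin.last 4) • z = 0 := (Submodule.disjoint_def.1 hU.disjoint) _ h2 h3
    rw [h4, add_zero] at hx
    have h5 : P *ᵥ (fun i => x i.castSucc) = 0 := by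
      have : u (P *ᵥ fun i => x i.castSucc) = 0 := Subtype.ext hx
      simpa using this
    have h6 := Matrix.eq_zero_of_mulVec_eq_zero hP h5
    ext i
    refine Fin.lastCases ?_ (fun i => ?_) i
    · simpa [hz] using h4
    · exact congrFun h6 i
  have hBval : LinearMap.toMatrix₂' ℂ (b.compl₁₂ (g ∘ₗ Matrix.toLin' P) (g ∘ₗ Matrix.toLin' P)) =
      B := by
    rw [← hPB, LinearMap.compl₁₂_comp_comp, LinearMap.toMatrix₂'_compl₁₂, LinearMap.toMatrix'_toLin']
  let e : (Fin 5 → ℂ) ≃ₗ[ℂ] V := LinearEquiv.ofInjectiveOfFinrankEq f hinj (by simp [hV])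
  refine AlgIso.symm ⟨e, fun x y => ?_⟩
  have he (x : Fin 5 → ℂ) : e x = f x := rfl
  rw [he, he, he, hb, mulOfMatrix_apply, map_smul]
  have h7 : f (Pi.single (Fin.last 4) 1) = z := by
    rw [hf]
    have : (fun i : Fin 4 => (Pi.single (Fin.last 4) 1 : Fin 5 → ℂ) i.castSucc) = 0 :=
      funext single_last_castSucc
    rw [this, Pi.single_eq_same]
    simp
  rw [h7]
  congr 1
  have h8 : b (f x) (f y) = (b.compl₁₂ (g ∘ₗ Matrix.toLin' P) (g ∘ₗ Matrix.toLin' P))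
      (fun i => x i.castSucc) (fun i => y i.castSucc) := by
    simp [hf, hzl, hzr]
  rw [h8, ← Matrix.toLinearMap₂'_toMatrix' (R := ℂ) (b.compl₁₂ _ _), hBval,
    Matrix.toLinearMap₂'_apply]
  simp only [smul_eq_mul]
  refine Finset.sum_congr rfl fun i _ => Finset.sum_congr rfl fun j _ => ?_
  ring

theorem IsNCHeisenberg.exists_label (hV : Module.finrank ℂ V = 5)
    (hm : IsNCHeisenberg m) (h0 : m ≠ 0) : ∃ L : Label, L.Admissible ∧ AlgIso m L.mul := by
  obtain ⟨A, hA⟩ := hm.exists_algIso_of_cong hV h0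
  obtain ⟨B, hB | ⟨L, hL, hB⟩, h⟩ := exists_canonical₄ A
  · obtain ⟨e, he⟩ := hA B h
    refine absurd ?_ h0
    ext x y
    rw [hB, mulOfMatrix_zero] at he
    simpa using he x y
  · exact ⟨L, hL, by rw [Label.mul, ← hB]; exact hA B h⟩

end Existence

/-! ### Derivations and infinitesimal isometries -/

/-- The Lie algebra of the isometry group of the bilinear form with matrix `A`. -/
def isoAlg (A : Matrix (Fin 4) (Fin 4) ℂ) : Submodule ℂ (Matrix (Fin 4) (Fin 4) ℂ) where
  carrier := {d | dᵀ * A + A * d = 0}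
  zero_mem' := by simp
  add_mem' := by
    intro d d' h h'
    simp only [Set.mem_ofPred_eq] at h h' ⊢
    calc (d + d')ᵀ * A + A * (d + d') = (dᵀ * A + A * d) + (d'ᵀ * A + A * d') := by
          simp only [Matrix.transpose_add, Matrix.add_mul, Matrix.mul_add]
          abel
      _ = 0 := by rw [h, h', add_zero]
  smul_mem' := by
    intro c d h
    simp only [Set.mem_ofPred_eq] at h ⊢
    rw [Matrix.transpose_smul, Matrix.smul_mul, Matrix.mul_smul, ← smul_add, h, smul_zero]

theorem mem_isoAlg_iff {A d : Matrix (Fin 4) (Fin 4) ℂ} :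
    d ∈ isoAlg A ↔ ∀ i j, ∑ k, d k i * A k j + ∑ k, A i k * d k j = 0 := by
  change dᵀ * A + A * d = 0 ↔ _
  rw [← Matrix.ext_iff]
  rfl

/-- The endomorphism of `ℂ⁵` given by a scalar `c`, a linear form `r` on `ℂ⁴` and an
endomorphism `d` of `ℂ⁴`. -/
noncomputable def extendEnd : ((Fin 4 → ℂ) × ℂ × Matrix (Fin 4) (Fin 4) ℂ) →ₗ[ℂ]
    Module.End ℂ (Fin 5 → ℂ) :=
  LinearMap.mk₂ ℂ
    (fun p x => Fin.snoc (fun i => ((p.2.2 *ᵥ fun j => x j.castSucc) i + p.2.1 / 2 * x i.castSucc))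
      ((p.1 ⬝ᵥ fun j => x j.castSucc) + p.2.1 * x (Fin.last 4)) : _ → _ → (Fin 5 → ℂ))
    (by
      intro p p' x
      ext i
      refine Fin.lastCases ?_ (fun i => ?_) i
      · simp only [Fin.snoc_last, Pi.add_apply, Prod.fst_add, Prod.snd_add, add_dotProduct]
        ring
      · simp only [Fin.snoc_castSucc, Pi.add_apply, Prod.fst_add, Prod.snd_add, Matrix.add_mulVec]
        ring)
    (by
      intro c p x
      ext i
      refine Fin.lastCases ?_ (fun i => ?_) i
      · simp only [Fin.snoc_last, Pi.smul_apply, Prod.smul_fst, Prod.smul_snd, smul_dotProduct,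
          smul_eq_mul]
        ring
      · simp only [Fin.snoc_castSucc, Pi.smul_apply, Prod.smul_fst, Prod.smul_snd,
          Matrix.smul_mulVec, smul_eq_mul]
        ring)
    (by
      intro p x y
      ext i
      have h : (fun j : Fin 4 => (x + y) j.castSucc) =
        (fun j => x j.castSucc) + fun j => y j.castSucc := rfl
      refine Fin.lastCases ?_ (fun i => ?_) i
      · simp only [h, Fin.snoc_last, dotProduct_add]
        simp only [Pi.add_apply, Fin.snoc_last]
        ring
      · simp only [h, Fin.snoc_castSucc, Matrix.mulVec_add]
        simp only [Pi.add_apply, Fin.snoc_castSucc]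
        ring)
    (by
      intro c p x
      ext i
      have h : (fun j : Fin 4 => (c • x) j.castSucc) = c • fun j => x j.castSucc := rfl
      refine Fin.lastCases ?_ (fun i => ?_) i
      · simp only [h, Fin.snoc_last, dotProduct_smul]
        simp only [Pi.smul_apply, Fin.snoc_last, smul_eq_mul]
        ring
      · simp only [h, Fin.snoc_castSucc, Matrix.mulVec_smul]
        simp only [Pi.smul_apply, Fin.snoc_castSucc, smul_eq_mul]
        ring)

section extendEnd

variable (p : (Fin 4 → ℂ) × ℂ × Matrix (Fin 4) (Fin 4) ℂ) (x : Fin 5 → ℂ)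

theorem extendEnd_apply_castSucc (i : Fin 4) : extendEnd p x i.castSucc =
    (p.2.2 *ᵥ fun j => x j.castSucc) i + p.2.1 / 2 * x i.castSucc := by
  simp only [extendEnd, LinearMap.mk₂_apply, Fin.snoc_castSucc]

theorem extendEnd_apply_last : extendEnd p x (Fin.last 4) =
    (p.1 ⬝ᵥ fun j => x j.castSucc) + p.2.1 * x (Fin.last 4) := by
  simp only [extendEnd, LinearMap.mk₂_apply, Fin.snoc_last]

theorem single_castSucc_comp (k : Fin 4) :
    (fun j : Fin 4 => (Pi.single k.castSucc 1 : Fin 5 → ℂ) j.castSucc) = Pi.single k 1 := by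
  ext j
  simp [Pi.single_apply]

theorem extendEnd_single_castSucc (k i : Fin 4) :
    extendEnd p (Pi.single k.castSucc 1) i.castSucc =
      p.2.2 i k + p.2.1 / 2 * (Pi.single k 1 : Fin 4 → ℂ) i := by
  rw [extendEnd_apply_castSucc, single_castSucc_comp, Matrix.mulVec_single_one,
    ← single_castSucc_comp]
  rfl

theorem extendEnd_single_castSucc_last (k : Fin 4) :
    extendEnd p (Pi.single k.castSucc 1) (Fin.last 4) = p.1 k := by
  rw [extendEnd_apply_last, single_castSucc_comp,
    Pi.single_eq_of_ne (Fin.castSucc_lt_last k).ne']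
  simp

theorem extendEnd_single_last :
    extendEnd p (Pi.single (Fin.last 4) 1) = Pi.single (Fin.last 4) p.2.1 := by
  have h : (fun j : Fin 4 => (Pi.single (Fin.last 4) 1 : Fin 5 → ℂ) j.castSucc) = 0 :=
    funext single_last_castSucc
  ext i
  refine Fin.lastCases ?_ (fun i => ?_) i
  · rw [extendEnd_apply_last, h, Pi.single_eq_same, Pi.single_eq_same]
    simp
  · rw [extendEnd_apply_castSucc, h, single_last_castSucc,
      Pi.single_eq_of_ne (Fin.castSucc_lt_last i).ne]
    simp

end extendEnd

theorem extendEnd_injective : Function.Injective extendEnd := by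
  rw [← LinearMap.ker_eq_bot, LinearMap.ker_eq_bot']
  rintro ⟨r, c, d⟩ h
  have hc : c = 0 := by
    have := congrFun (extendEnd_single_last (r, c, d)) (Fin.last 4)
    rw [h, Pi.single_eq_same] at this
    exact this.symm
  subst hc
  have hr : r = 0 := by
    ext k
    have := extendEnd_single_castSucc_last (r, 0, d) k
    rw [h] at this
    exact this.symm
  have hd : d = 0 := by
    ext i k
    have := extendEnd_single_castSucc (r, 0, d) k i
    rw [h] at this
    simpa using this.symm
  rw [hr, hd]
  rfl

/-- A derivation scaling e₅ by c must satisfy b(Dx, y) + b(x, Dy) = c b(x, y). The summand c/2 in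
`extendEnd` absorbs the right side, and r is unconstrained because e₅ annihilates everything. -/
theorem extendEnd_mem_derivations_iff {A : Matrix (Fin 4) (Fin 4) ℂ}
    {p : (Fin 4 → ℂ) × ℂ × Matrix (Fin 4) (Fin 4) ℂ} :
    extendEnd p ∈ derivations (mulOfMatrix A) ↔ p.2.2 ∈ isoAlg A := by
  have key (x y : Fin 5 → ℂ) : (∀ i, extendEnd p (mulOfMatrix A x y) i =
      (mulOfMatrix A (extendEnd p x) y + mulOfMatrix A x (extendEnd p y)) i) ↔
      (fun i => x i.castSucc) ⬝ᵥ ((p.2.2ᵀ * A + A * p.2.2) *ᵥ fun i => y i.castSucc) = 0 := by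
    have hb (x y : Fin 5 → ℂ) : mulOfMatrix A x y =
        ((fun i => x i.castSucc) ⬝ᵥ (A *ᵥ fun i => y i.castSucc)) •
          (Pi.single (Fin.last 4) 1 : Fin 5 → ℂ) := by
      rw [mulOfMatrix_apply]
      congr 1
      simp only [dotProduct, mulVec, Finset.mul_sum, mul_assoc]
    have hc (x : Fin 5 → ℂ) : (fun i : Fin 4 => extendEnd p x i.castSucc) =
        (p.2.2 *ᵥ fun i => x i.castSucc) + (p.2.1 / 2) • fun i => x i.castSucc := by
      ext i
      rw [extendEnd_apply_castSucc]
      rfl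
    rw [hb, hb, hb, map_smul, extendEnd_single_last, hc, hc, Fin.forall_fin_succ']
    simp only [Pi.smul_apply, Pi.add_apply, Pi.single_eq_same, smul_zero,
      Pi.single_eq_of_ne (Fin.castSucc_lt_last _).ne, add_zero, implies_true, true_and]
    rw [Matrix.add_mulVec, dotProduct_add, ← Matrix.mulVec_mulVec, ← Matrix.mulVec_mulVec,
      Matrix.dotProduct_mulVec _ p.2.2ᵀ, Matrix.vecMul_transpose, Matrix.mulVec_add,
      Matrix.mulVec_smul, dotProduct_add, add_dotProduct, dotProduct_smul, smul_dotProduct]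
    simp only [smul_eq_mul, mul_one]
    constructor <;> intro h <;> linear_combination -h
  constructor
  · intro h
    change p.2.2ᵀ * A + A * p.2.2 = 0
    ext i j
    have := (key (Pi.single i.castSucc 1) (Pi.single j.castSucc 1)).1 fun k => congrFun (h _ _) k
    rw [single_castSucc_comp, single_castSucc_comp] at this
    simpa using this
  · intro h x y
    have h' : p.2.2ᵀ * A + A * p.2.2 = 0 := h
    exact funext ((key x y).2 (by rw [h']; simp))

theorem mem_range_extendEnd_of_mem_derivations {A : Matrix (Fin 4) (Fin 4) ℂ} (hA : A ≠ 0)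
    {D : Module.End ℂ (Fin 5 → ℂ)} (hD : D ∈ derivations (mulOfMatrix A)) :
    ∃ p, extendEnd p = D := by
  set z : Fin 5 → ℂ := Pi.single (Fin.last 4) 1 with hz
  obtain ⟨c, hc⟩ : ∃ c, D z = c • z := by
    obtain ⟨i, j, hij⟩ : ∃ i j, A i j ≠ 0 := by
      by_contra! h
      exact hA (by ext i j; exact h i j)
    have h1 := hD (Pi.single i.castSucc 1) (Pi.single j.castSucc 1)
    rw [mulOfMatrix_single_castSucc, mulOfMatrix_apply, mulOfMatrix_apply, ← hz, ← add_smul,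
      map_smul] at h1
    exact ⟨(A i j)⁻¹ * _, by rw [mul_smul, ← h1, smul_smul, inv_mul_cancel₀ hij, one_smul]⟩
  refine ⟨(fun k => D (Pi.single k.castSucc 1) (Fin.last 4), c, Matrix.of fun i k =>
    D (Pi.single k.castSucc 1) i.castSucc - c / 2 * (Pi.single k 1 : Fin 4 → ℂ) i), ?_⟩
  refine LinearMap.pi_ext' fun k => LinearMap.ext_ring ?_
  simp only [LinearMap.comp_apply, LinearMap.single_apply]
  refine Fin.lastCases ?_ (fun k => ?_) k
  · rw [extendEnd_single_last, ← hz, hc, hz]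
    ext i
    rw [Pi.smul_apply, Pi.single_apply, Pi.single_apply]
    split_ifs
    · exact (mul_one c).symm
    · exact (mul_zero c).symm
  · ext i
    refine Fin.lastCases ?_ (fun i => ?_) i
    · rw [extendEnd_single_castSucc_last]
    · rw [extendEnd_single_castSucc]
      exact sub_add_cancel _ _

theorem finrank_derivations_mulOfMatrix {A : Matrix (Fin 4) (Fin 4) ℂ} (hA : A ≠ 0) :
    Module.finrank ℂ (derivations (mulOfMatrix A)) = 5 + Module.finrank ℂ (isoAlg A) := by
  let f : ((Fin 4 → ℂ) × ℂ × isoAlg A) →ₗ[ℂ] Module.End ℂ (Fin 5 → ℂ) :=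
    extendEnd ∘ₗ LinearMap.prodMap LinearMap.id (LinearMap.prodMap LinearMap.id (isoAlg A).subtype)
  have hf : Function.Injective f := by
    rintro ⟨r, c, d⟩ ⟨r', c', d'⟩ h
    have h' : (r, c, d.1) = (r', c', d'.1) := extendEnd_injective h
    simp only [Prod.mk.injEq] at h' ⊢
    exact ⟨h'.1, h'.2.1, Subtype.ext h'.2.2⟩
  have hr : LinearMap.range f = derivations (mulOfMatrix A) := by
    ext D
    constructor
    · rintro ⟨⟨r, c, d⟩, rfl⟩
      exact extendEnd_mem_derivations_iff.2 d.2
    · intro hD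
      obtain ⟨⟨r, c, d⟩, rfl⟩ := mem_range_extendEnd_of_mem_derivations hA hD
      exact ⟨(r, c, ⟨d, extendEnd_mem_derivations_iff.1 hD⟩), rfl⟩
  rw [← hr, LinearMap.finrank_range_of_inj hf, Module.finrank_prod, Module.finrank_prod]
  simp
  ring

/-- The positions s are the free entries of a solution, and M rebuilds the solution from them. -/
theorem finrank_eq_of_parametrization {k : ℕ} {S : Submodule ℂ (Matrix (Fin 4) (Fin 4) ℂ)}
    (s : Fin k → Fin 4 × Fin 4) (M : (Fin k → ℂ) → Matrix (Fin 4) (Fin 4) ℂ)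
    (h1 : ∀ c, M c ∈ S) (h2 : ∀ c i, M c (s i).1 (s i).2 = c i)
    (h3 : ∀ d ∈ S, d = M fun i => d (s i).1 (s i).2) : Module.finrank ℂ S = k := by
  let f : S →ₗ[ℂ] (Fin k → ℂ) :=
    { toFun := fun d i => d.1 (s i).1 (s i).2
      map_add' := fun _ _ => rfl
      map_smul' := fun _ _ => rfl }
  have hf : Function.Bijective f := by
    refine ⟨fun d d' h => ?_, fun c => ⟨⟨M c, h1 c⟩, funext (h2 c)⟩⟩
    have h' : (fun i => d.1 (s i).1 (s i).2) = fun i => d'.1 (s i).1 (s i).2 := h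
    exact Subtype.ext (by rw [h3 d.1 d.2, h3 d'.1 d'.2, h'])
  rw [(LinearEquiv.ofBijective f hf).finrank_eq]
  simp

/-! ### Infinitesimal isometries of the listed forms -/

theorem finrank_isoAlg_h01 :
    Module.finrank ℂ (isoAlg (Label.table .h01)) = 12 := by
  refine finrank_eq_of_parametrization ![(1, 0), (1, 1), (1, 2), (1, 3), (2, 0), (2, 1), (2, 2),
      (2, 3), (3, 0), (3, 1), (3, 2), (3, 3)]
    (fun c => !![0, 0, 0, 0; c 0, c 1, c 2, c 3; c 4, c 5, c 6, c 7; c 8, c 9, c 10, c 11]) ?_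
      ?_ ?_
  · intro c
    simp [mem_isoAlg_iff, Fin.forall_fin_succ, Fin.sum_univ_four, Label.table]
  · intro c i
    fin_cases i <;> rfl
  · intro d hd
    simp [mem_isoAlg_iff, Fin.forall_fin_succ, Fin.sum_univ_four, Label.table] at hd
    ext i j
    fin_cases i <;> fin_cases j <;> simp <;> grind

theorem finrank_isoAlg_h02 :
    Module.finrank ℂ (isoAlg (Label.table .h02)) = 9 := by
  refine finrank_eq_of_parametrization ![(0, 1), (2, 0), (2, 1), (2, 2), (2, 3), (3, 0), (3, 1),
      (3, 2), (3, 3)]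
    (fun c => !![0, c 0, 0, 0; 0, 0, 0, 0; c 1, c 2, c 3, c 4; c 5, c 6, c 7, c 8]) ?_ ?_ ?_
  · intro c
    simp [mem_isoAlg_iff, Fin.forall_fin_succ, Fin.sum_univ_four, Label.table]
  · intro c i
    fin_cases i <;> rfl
  · intro d hd
    simp [mem_isoAlg_iff, Fin.forall_fin_succ, Fin.sum_univ_four, Label.table] at hd
    ext i j
    fin_cases i <;> fin_cases j <;> simp <;> grind

theorem finrank_isoAlg_h03 {l : ℂ} (h : l ≠ -1) :
    Module.finrank ℂ (isoAlg (Label.table (.h03 l))) = 9 := by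
  refine finrank_eq_of_parametrization ![(0, 0), (2, 0), (2, 1), (2, 2), (2, 3), (3, 0), (3, 1),
      (3, 2), (3, 3)]
    (fun c => !![c 0, 0, 0, 0; 0, -c 0, 0, 0; c 1, c 2, c 3, c 4; c 5, c 6, c 7, c 8]) ?_ ?_ ?_
  · intro c
    simp [mem_isoAlg_iff, Fin.forall_fin_succ, Fin.sum_univ_four, Label.table]
    grind
  · intro c i
    fin_cases i <;> rfl
  · intro d hd
    simp [mem_isoAlg_iff, Fin.forall_fin_succ, Fin.sum_univ_four, Label.table] at hd
    ext i j
    fin_cases i <;> fin_cases j <;> simp <;> grind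

theorem finrank_isoAlg_h03_neg_one :
    Module.finrank ℂ (isoAlg (Label.table (.h03 (-1)))) = 11 := by
  refine finrank_eq_of_parametrization ![(0, 0), (0, 1), (1, 0), (2, 0), (2, 1), (2, 2), (2, 3),
      (3, 0), (3, 1), (3, 2), (3, 3)]
    (fun c => !![c 0, c 1, 0, 0; c 2, -c 0, 0, 0; c 3, c 4, c 5, c 6; c 7, c 8, c 9, c 10]) ?_
      ?_ ?_
  · intro c
    simp [mem_isoAlg_iff, Fin.forall_fin_succ, Fin.sum_univ_four, Label.table]
  · intro c i
    fin_cases i <;> rfl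
  · intro d hd
    simp [mem_isoAlg_iff, Fin.forall_fin_succ, Fin.sum_univ_four, Label.table] at hd
    ext i j
    fin_cases i <;> fin_cases j <;> simp <;> grind

theorem finrank_isoAlg_h04 :
    Module.finrank ℂ (isoAlg (Label.table .h04)) = 5 := by
  refine finrank_eq_of_parametrization ![(1, 2), (3, 0), (3, 1), (3, 2), (3, 3)]
    (fun c => !![0, 0, 0, 0; 0, 0, c 0, 0; 0, 0, 0, 0; c 1, c 2, c 3, c 4]) ?_ ?_ ?_
  · intro c
    simp [mem_isoAlg_iff, Fin.forall_fin_succ, Fin.sum_univ_four, Label.table]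
  · intro c i
    fin_cases i <;> rfl
  · intro d hd
    simp [mem_isoAlg_iff, Fin.forall_fin_succ, Fin.sum_univ_four, Label.table] at hd
    ext i j
    fin_cases i <;> fin_cases j <;> simp <;> grind

theorem finrank_isoAlg_h05 {l : ℂ} (h : l ^ 2 ≠ 1) :
    Module.finrank ℂ (isoAlg (Label.table (.h05 l))) = 5 := by
  refine finrank_eq_of_parametrization ![(1, 1), (3, 0), (3, 1), (3, 2), (3, 3)]
    (fun c => !![0, 0, 0, 0; 0, c 0, 0, 0; 0, 0, -c 0, 0; c 1, c 2, c 3, c 4]) ?_ ?_ ?_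
  · intro c
    simp [mem_isoAlg_iff, Fin.forall_fin_succ, Fin.sum_univ_four, Label.table]
    grind
  · intro c i
    fin_cases i <;> rfl
  · intro d hd
    simp [mem_isoAlg_iff, Fin.forall_fin_succ, Fin.sum_univ_four, Label.table] at hd
    ext i j
    fin_cases i <;> fin_cases j <;> simp <;> grind

theorem finrank_isoAlg_h05_one :
    Module.finrank ℂ (isoAlg (Label.table (.h05 1))) = 7 := by
  refine finrank_eq_of_parametrization ![(0, 1), (0, 2), (1, 1), (3, 0), (3, 1), (3, 2), (3, 3)]
    (fun c => !![0, c 0, c 1, 0; -c 1, c 2, 0, 0; -c 0, 0, -c 2, 0; c 3, c 4, c 5, c 6]) ?_ ?_ ?_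
  · intro c
    simp [mem_isoAlg_iff, Fin.forall_fin_succ, Fin.sum_univ_four, Label.table]
  · intro c i
    fin_cases i <;> rfl
  · intro d hd
    simp [mem_isoAlg_iff, Fin.forall_fin_succ, Fin.sum_univ_four, Label.table] at hd
    ext i j
    fin_cases i <;> fin_cases j <;> simp <;> grind

theorem finrank_isoAlg_h05_neg_one :
    Module.finrank ℂ (isoAlg (Label.table (.h05 (-1)))) = 7 := by
  refine finrank_eq_of_parametrization ![(1, 1), (1, 2), (2, 1), (3, 0), (3, 1), (3, 2), (3, 3)]
    (fun c => !![0, 0, 0, 0; 0, c 0, c 1, 0; 0, c 2, -c 0, 0; c 3, c 4, c 5, c 6]) ?_ ?_ ?_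
  · intro c
    simp [mem_isoAlg_iff, Fin.forall_fin_succ, Fin.sum_univ_four, Label.table]
  · intro c i
    fin_cases i <;> rfl
  · intro d hd
    simp [mem_isoAlg_iff, Fin.forall_fin_succ, Fin.sum_univ_four, Label.table] at hd
    ext i j
    fin_cases i <;> fin_cases j <;> simp <;> grind

theorem finrank_isoAlg_h06 :
    Module.finrank ℂ (isoAlg (Label.table .h06)) = 6 := by
  refine finrank_eq_of_parametrization ![(0, 0), (0, 1), (3, 0), (3, 1), (3, 2), (3, 3)]
    (fun c => !![c 0, c 1, 0, 0; 0, -c 0, 0, 0; 0, -c 1, c 0, 0; c 2, c 3, c 4, c 5]) ?_ ?_ ?_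
  · intro c
    simp [mem_isoAlg_iff, Fin.forall_fin_succ, Fin.sum_univ_four, Label.table]
  · intro c i
    fin_cases i <;> rfl
  · intro d hd
    simp [mem_isoAlg_iff, Fin.forall_fin_succ, Fin.sum_univ_four, Label.table] at hd
    ext i j
    fin_cases i <;> fin_cases j <;> simp <;> grind

theorem finrank_isoAlg_h07 :
    Module.finrank ℂ (isoAlg (Label.table .h07)) = 5 := by
  refine finrank_eq_of_parametrization ![(0, 1), (3, 0), (3, 1), (3, 2), (3, 3)]
    (fun c => !![0, c 0, 0, 0; 0, 0, c 0, 0; 0, 0, 0, 0; c 1, c 2, c 3, c 4]) ?_ ?_ ?_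
  · intro c
    simp [mem_isoAlg_iff, Fin.forall_fin_succ, Fin.sum_univ_four, Label.table]
  · intro c i
    fin_cases i <;> rfl
  · intro d hd
    simp [mem_isoAlg_iff, Fin.forall_fin_succ, Fin.sum_univ_four, Label.table] at hd
    ext i j
    fin_cases i <;> fin_cases j <;> simp <;> grind

theorem finrank_isoAlg_h08 :
    Module.finrank ℂ (isoAlg (Label.table .h08)) = 2 := by
  refine finrank_eq_of_parametrization ![(0, 1), (0, 3)]
    (fun c => !![0, c 0, 0, c 1; 0, 0, c 0, 0; 0, 0, 0, c 0; 0, 0, 0, 0]) ?_ ?_ ?_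
  · intro c
    simp [mem_isoAlg_iff, Fin.forall_fin_succ, Fin.sum_univ_four, Label.table]
  · intro c i
    fin_cases i <;> rfl
  · intro d hd
    simp [mem_isoAlg_iff, Fin.forall_fin_succ, Fin.sum_univ_four, Label.table] at hd
    ext i j
    fin_cases i <;> fin_cases j <;> simp <;> grind

theorem finrank_isoAlg_h09 {l : ℂ} (h : l ^ 2 ≠ 1) :
    Module.finrank ℂ (isoAlg (Label.table (.h09 l))) = 2 := by
  refine finrank_eq_of_parametrization ![(0, 0), (0, 1)]
    (fun c => !![c 0, c 1, 0, 0; 0, c 0, 0, 0; 0, 0, -c 0, 0; 0, 0, -c 1, -c 0]) ?_ ?_ ?_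
  · intro c
    simp [mem_isoAlg_iff, Fin.forall_fin_succ, Fin.sum_univ_four, Label.table]
    grind
  · intro c i
    fin_cases i <;> rfl
  · intro d hd
    simp [mem_isoAlg_iff, Fin.forall_fin_succ, Fin.sum_univ_four, Label.table] at hd
    ext i j
    fin_cases i <;> fin_cases j <;> simp <;> grind

theorem finrank_isoAlg_h09_one :
    Module.finrank ℂ (isoAlg (Label.table (.h09 1))) = 4 := by
  refine finrank_eq_of_parametrization ![(0, 0), (0, 1), (0, 2), (2, 1)]
    (fun c => !![c 0, c 1, c 2, 2 * c 2; 0, c 0, -2 * c 2, 0; 0, c 3, -c 0, 0; -c 3, -c 3 / 2,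
      -c 1, -c 0]) ?_ ?_ ?_
  · intro c
    simp [mem_isoAlg_iff, Fin.forall_fin_succ, Fin.sum_univ_four, Label.table]
    grind
  · intro c i
    fin_cases i <;> rfl
  · intro d hd
    simp [mem_isoAlg_iff, Fin.forall_fin_succ, Fin.sum_univ_four, Label.table] at hd
    ext i j
    fin_cases i <;> fin_cases j <;> simp <;> grind

theorem finrank_isoAlg_h10 :
    Module.finrank ℂ (isoAlg (Label.table .h10)) = 3 := by
  refine finrank_eq_of_parametrization ![(0, 2), (1, 1), (1, 2)]
    (fun c => !![0, 0, c 0, 0; -c 0, c 1, c 2, 0; 0, 0, -c 1, 0; -c 0, 0, -c 2, c 1]) ?_ ?_ ?_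
  · intro c
    simp [mem_isoAlg_iff, Fin.forall_fin_succ, Fin.sum_univ_four, Label.table]
  · intro c i
    fin_cases i <;> rfl
  · intro d hd
    simp [mem_isoAlg_iff, Fin.forall_fin_succ, Fin.sum_univ_four, Label.table] at hd
    ext i j
    fin_cases i <;> fin_cases j <;> simp <;> grind

theorem finrank_isoAlg_h11 :
    Module.finrank ℂ (isoAlg (Label.table .h11)) = 2 := by
  refine finrank_eq_of_parametrization ![(0, 3), (1, 2)]
    (fun c => !![0, 0, 0, c 0; -c 0, 0, c 1, 0; 0, 0, 0, c 1; 0, 0, 0, 0]) ?_ ?_ ?_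
  · intro c
    simp [mem_isoAlg_iff, Fin.forall_fin_succ, Fin.sum_univ_four, Label.table]
  · intro c i
    fin_cases i <;> rfl
  · intro d hd
    simp [mem_isoAlg_iff, Fin.forall_fin_succ, Fin.sum_univ_four, Label.table] at hd
    ext i j
    fin_cases i <;> fin_cases j <;> simp <;> grind

theorem finrank_isoAlg_h12 :
    Module.finrank ℂ (isoAlg (Label.table .h12)) = 4 := by
  refine finrank_eq_of_parametrization ![(0, 1), (0, 2), (0, 3), (2, 3)]
    (fun c => !![0, c 0, c 1, c 2; 0, 0, 0, c 1; -c 1, c 2, 0, c 3; 0, -c 1, 0, 0]) ?_ ?_ ?_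
  · intro c
    simp [mem_isoAlg_iff, Fin.forall_fin_succ, Fin.sum_univ_four, Label.table]
    grind
  · intro c i
    fin_cases i <;> rfl
  · intro d hd
    simp [mem_isoAlg_iff, Fin.forall_fin_succ, Fin.sum_univ_four, Label.table] at hd
    ext i j
    fin_cases i <;> fin_cases j <;> simp <;> grind

/-- Generically the planes do not interact and each contributes a torus. The exceptional cases below
give gl₂ when l = m with l² ≠ 1, an sl₂ in place of a torus for a single parameter -1, so₄ for (1,
1) and sp₄ for (-1, -1). -/
theorem finrank_isoAlg_h13 {l m : ℂ} (h : l ≠ m) (h' : l * m ≠ 1) (hl : l ≠ -1)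
    (hm : m ≠ -1) :
    Module.finrank ℂ (isoAlg (Label.table (.h13 l m))) = 2 := by
  refine finrank_eq_of_parametrization ![(0, 0), (2, 2)]
    (fun c => !![c 0, 0, 0, 0; 0, -c 0, 0, 0; 0, 0, c 1, 0; 0, 0, 0, -c 1]) ?_ ?_ ?_
  · intro c
    simp [mem_isoAlg_iff, Fin.forall_fin_succ, Fin.sum_univ_four, Label.table]
    grind
  · intro c i
    fin_cases i <;> rfl
  · intro d hd
    simp [mem_isoAlg_iff, Fin.forall_fin_succ, Fin.sum_univ_four, Label.table] at hd
    ext i j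
    fin_cases i <;> fin_cases j <;> simp <;> grind

theorem finrank_isoAlg_h13_self {l : ℂ} (h : l ^ 2 ≠ 1) :
    Module.finrank ℂ (isoAlg (Label.table (.h13 l l))) = 4 := by
  refine finrank_eq_of_parametrization ![(0, 0), (0, 2), (1, 3), (2, 2)]
    (fun c => !![c 0, 0, c 1, 0; 0, -c 0, 0, c 2; -c 2, 0, c 3, 0; 0, -c 1, 0, -c 3]) ?_ ?_ ?_
  · intro c
    simp [mem_isoAlg_iff, Fin.forall_fin_succ, Fin.sum_univ_four, Label.table]
    grind
  · intro c i
    fin_cases i <;> rfl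
  · intro d hd
    simp [mem_isoAlg_iff, Fin.forall_fin_succ, Fin.sum_univ_four, Label.table] at hd
    ext i j
    fin_cases i <;> fin_cases j <;> simp <;> grind

theorem finrank_isoAlg_h13_neg_one_right {l : ℂ} (h : l ≠ -1) :
    Module.finrank ℂ (isoAlg (Label.table (.h13 l (-1)))) = 4 := by
  refine finrank_eq_of_parametrization ![(0, 0), (0, 1), (1, 0), (2, 2)]
    (fun c => !![c 0, c 1, 0, 0; c 2, -c 0, 0, 0; 0, 0, c 3, 0; 0, 0, 0, -c 3]) ?_ ?_ ?_
  · intro c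
    simp [mem_isoAlg_iff, Fin.forall_fin_succ, Fin.sum_univ_four, Label.table]
    grind
  · intro c i
    fin_cases i <;> rfl
  · intro d hd
    simp [mem_isoAlg_iff, Fin.forall_fin_succ, Fin.sum_univ_four, Label.table] at hd
    ext i j
    fin_cases i <;> fin_cases j <;> simp <;> grind

theorem finrank_isoAlg_h13_neg_one_left {m : ℂ} (h : m ≠ -1) :
    Module.finrank ℂ (isoAlg (Label.table (.h13 (-1) m))) = 4 := by
  refine finrank_eq_of_parametrization ![(0, 0), (2, 2), (2, 3), (3, 2)]
    (fun c => !![c 0, 0, 0, 0; 0, -c 0, 0, 0; 0, 0, c 1, c 2; 0, 0, c 3, -c 1]) ?_ ?_ ?_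
  · intro c
    simp [mem_isoAlg_iff, Fin.forall_fin_succ, Fin.sum_univ_four, Label.table]
    grind
  · intro c i
    fin_cases i <;> rfl
  · intro d hd
    simp [mem_isoAlg_iff, Fin.forall_fin_succ, Fin.sum_univ_four, Label.table] at hd
    ext i j
    fin_cases i <;> fin_cases j <;> simp <;> grind

theorem finrank_isoAlg_h13_one_one :
    Module.finrank ℂ (isoAlg (Label.table (.h13 1 1))) = 6 := by
  refine finrank_eq_of_parametrization ![(0, 0), (0, 2), (0, 3), (1, 2), (1, 3), (2, 2)]
    (fun c => !![c 0, 0, c 1, c 2; 0, -c 0, c 3, c 4; -c 4, -c 2, c 5, 0; -c 3, -c 1, 0, -c 5])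
      ?_ ?_ ?_
  · intro c
    simp [mem_isoAlg_iff, Fin.forall_fin_succ, Fin.sum_univ_four, Label.table]
  · intro c i
    fin_cases i <;> rfl
  · intro d hd
    simp [mem_isoAlg_iff, Fin.forall_fin_succ, Fin.sum_univ_four, Label.table] at hd
    ext i j
    fin_cases i <;> fin_cases j <;> simp <;> grind

theorem finrank_isoAlg_h13_neg_one_neg_one :
    Module.finrank ℂ (isoAlg (Label.table (.h13 (-1) (-1)))) = 10 := by
  refine finrank_eq_of_parametrization ![(0, 0), (0, 1), (0, 2), (0, 3), (1, 0), (1, 2), (1, 3),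
      (2, 2), (2, 3), (3, 2)]
    (fun c => !![c 0, c 1, c 2, c 3; c 4, -c 0, c 5, c 6; -c 6, c 3, c 7, c 8; c 5, -c 2, c 9,
      -c 7]) ?_ ?_ ?_
  · intro c
    simp [mem_isoAlg_iff, Fin.forall_fin_succ, Fin.sum_univ_four, Label.table]
  · intro c i
    fin_cases i <;> rfl
  · intro d hd
    simp [mem_isoAlg_iff, Fin.forall_fin_succ, Fin.sum_univ_four, Label.table] at hd
    ext i j
    fin_cases i <;> fin_cases j <;> simp <;> grind

theorem finrank_isoAlg_h14 {l : ℂ} (h : l ≠ -1) :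
    Module.finrank ℂ (isoAlg (Label.table (.h14 l))) = 2 := by
  refine finrank_eq_of_parametrization ![(0, 0), (2, 3)]
    (fun c => !![c 0, 0, 0, 0; 0, -c 0, 0, 0; 0, 0, 0, c 1; 0, 0, 0, 0]) ?_ ?_ ?_
  · intro c
    simp [mem_isoAlg_iff, Fin.forall_fin_succ, Fin.sum_univ_four, Label.table]
    grind
  · intro c i
    fin_cases i <;> rfl
  · intro d hd
    simp [mem_isoAlg_iff, Fin.forall_fin_succ, Fin.sum_univ_four, Label.table] at hd
    ext i j
    fin_cases i <;> fin_cases j <;> simp <;> grind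

theorem finrank_isoAlg_h14_neg_one :
    Module.finrank ℂ (isoAlg (Label.table (.h14 (-1)))) = 6 := by
  refine finrank_eq_of_parametrization ![(0, 0), (0, 1), (0, 3), (1, 0), (1, 3), (2, 3)]
    (fun c => !![c 0, c 1, 0, c 2; c 3, -c 0, 0, c 4; c 4, -c 2, 0, c 5; 0, 0, 0, 0]) ?_ ?_ ?_
  · intro c
    simp [mem_isoAlg_iff, Fin.forall_fin_succ, Fin.sum_univ_four, Label.table]
  · intro c i
    fin_cases i <;> rfl
  · intro d hd
    simp [mem_isoAlg_iff, Fin.forall_fin_succ, Fin.sum_univ_four, Label.table] at hd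
    ext i j
    fin_cases i <;> fin_cases j <;> simp <;> grind

theorem finrank_isoAlg_h15 :
    Module.finrank ℂ (isoAlg (Label.table .h15)) = 2 := by
  refine finrank_eq_of_parametrization ![(0, 0), (0, 2)]
    (fun c => !![c 0, 0, c 1, 0; 0, -c 0, 0, 0; 0, 0, c 0, 0; 0, -c 1, 0, -c 0]) ?_ ?_ ?_
  · intro c
    simp [mem_isoAlg_iff, Fin.forall_fin_succ, Fin.sum_univ_four, Label.table]
  · intro c i
    fin_cases i <;> rfl
  · intro d hd
    simp [mem_isoAlg_iff, Fin.forall_fin_succ, Fin.sum_univ_four, Label.table] at hd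
    ext i j
    fin_cases i <;> fin_cases j <;> simp <;> grind

namespace Label

theorem finrank_derivations (L : Label) (hL : L.Admissible) :
    Module.finrank ℂ (derivations L.mul) = L.derDim := by
  rw [mul, finrank_derivations_mulOfMatrix L.table_ne_zero]
  cases L with
  | h01 => rw [finrank_isoAlg_h01, derDim]
  | h02 => rw [finrank_isoAlg_h02, derDim]
  | h03 l =>
    by_cases h : l = -1
    · subst h
      simp [finrank_isoAlg_h03_neg_one, derDim, delta]
    · simp [finrank_isoAlg_h03 h, derDim, delta, h]
  | h04 => rw [finrank_isoAlg_h04, derDim]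
  | h05 l =>
    by_cases h : l ^ 2 = 1
    · rcases mul_self_eq_one_iff.1 ((sq l).symm.trans h) with rfl | rfl
      · norm_num [finrank_isoAlg_h05_one, derDim, delta]
      · norm_num [finrank_isoAlg_h05_neg_one, derDim, delta]
    · have h1 : l ≠ 1 := by rintro rfl; simp at h
      have h2 : l ≠ -1 := by rintro rfl; simp at h
      simp [finrank_isoAlg_h05 h, derDim, delta, h1, h2]
  | h06 => rw [finrank_isoAlg_h06, derDim]
  | h07 => rw [finrank_isoAlg_h07, derDim]
  | h08 => rw [finrank_isoAlg_h08, derDim]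
  | h09 l =>
    by_cases h1 : l = 1
    · subst h1
      simp [finrank_isoAlg_h09_one, derDim, delta]
    · have h : l ^ 2 ≠ 1 := fun h => (mul_self_eq_one_iff.1 ((sq l).symm.trans h)).elim h1 hL.2.1
      simp [finrank_isoAlg_h09 h, derDim, delta, h1]
  | h10 => rw [finrank_isoAlg_h10, derDim]
  | h11 => rw [finrank_isoAlg_h11, derDim]
  | h12 => rw [finrank_isoAlg_h12, derDim]
  | h13 l m =>
    have hne : (-1 : ℂ) ≠ 1 := by norm_num
    by_cases hl : l = -1 <;> by_cases hm : m = -1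
    · subst hl hm
      simp [finrank_isoAlg_h13_neg_one_neg_one, derDim, delta, hne]
    · subst hl
      simp [finrank_isoAlg_h13_neg_one_left hm, derDim, delta, hm, hne, Ne.symm hm]
    · subst hm
      simp [finrank_isoAlg_h13_neg_one_right hl, derDim, delta, hl, hne]
    · by_cases h : l = m
      · subst h
        by_cases h1 : l = 1
        · subst h1
          simp [finrank_isoAlg_h13_one_one, derDim, delta, hne.symm]
        · have h2 : l ^ 2 ≠ 1 := fun h => (mul_self_eq_one_iff.1 ((sq l).symm.trans h)).elim h1 hl
          simp [finrank_isoAlg_h13_self h2, derDim, delta, hl, h1]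
      · have h1 : l * m ≠ 1 := fun h' =>
          h (eq_of_mul_eq_one_of_mem_unitDiscHalf hL.1 hL.2.1 h')
        have h2 : m = 1 → l ≠ 1 := by
          rintro rfl rfl
          exact h rfl
        simp [finrank_isoAlg_h13 h h1 hl hm, derDim, delta, hl, hm, h]
        exact h2
  | h14 l =>
    by_cases h : l = -1
    · subst h
      simp [finrank_isoAlg_h14_neg_one, derDim, delta]
    · simp [finrank_isoAlg_h14 h, derDim, delta, h]
  | h15 => rw [finrank_isoAlg_h15, derDim]

end Label

/-! ### Pairwise non-isomorphism -/

/-- Taking determinants in c(A - tAᵀ) = Pᵀ(B - tBᵀ)P needs only c ≠ 0, not the invertibility of P.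
-/
theorem det_sub_smul_transpose_eq_zero_of_smul {n : ℕ} {A B P : Matrix (Fin n) (Fin n) ℂ} {c : ℂ}
    (hc : c ≠ 0) (h : Pᵀ * B * P = c • A) {t : ℂ} (ht : (B - t • Bᵀ).det = 0) :
    (A - t • Aᵀ).det = 0 := by
  have h1 : c • (A - t • Aᵀ) = Pᵀ * (B - t • Bᵀ) * P := by
    have h2 : Pᵀ * Bᵀ * P = c • Aᵀ := by
      rw [← Matrix.transpose_smul, ← h]
      simp [Matrix.mul_assoc]
    rw [Matrix.mul_sub, Matrix.sub_mul, h, Matrix.mul_smul, Matrix.smul_mul, h2, smul_sub,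
      smul_comm]
  have h3 := congrArg Matrix.det h1
  rw [Matrix.det_smul, Matrix.det_mul, Matrix.det_mul, ht] at h3
  simpa [hc] using h3

theorem submatrix_castSucc_congr {n : ℕ} {A B P : Matrix (Fin (n + 1)) (Fin (n + 1)) ℂ} {c : ℂ}
    (hr : ∀ j, B (Fin.last n) j = 0) (hl : ∀ i, B i (Fin.last n) = 0) (h : Pᵀ * B * P = c • A) :
    (P.submatrix Fin.castSucc Fin.castSucc)ᵀ * B.submatrix Fin.castSucc Fin.castSucc *
      P.submatrix Fin.castSucc Fin.castSucc = c • A.submatrix Fin.castSucc Fin.castSucc := by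
  ext i j
  have := congrFun (congrFun h i.castSucc) j.castSucc
  simpa [Matrix.mul_apply, Fin.sum_univ_castSucc, hr, hl] using this

section

variable {A B : Matrix (Fin 4) (Fin 4) ℂ}

theorem AlgIso.det_eq_zero (hA : A ≠ 0) (h : AlgIso (mulOfMatrix A) (mulOfMatrix B)) {t : ℂ}
    (ht : (B - t • Bᵀ).det = 0) : (A - t • Aᵀ).det = 0 := by
  obtain ⟨P, c, hc, hP⟩ := exists_transpose_mul_mul_eq_smul hA h
  exact det_sub_smul_transpose_eq_zero_of_smul hc hP ht

theorem AlgIso.det_eq_zero_three (hA : A ≠ 0) (h : AlgIso (mulOfMatrix A) (mulOfMatrix B))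
    {B' : Matrix (Fin 3) (Fin 3) ℂ} (hB' : B.submatrix Fin.castSucc Fin.castSucc = B')
    (hr : ∀ j, B (Fin.last 3) j = 0) (hl : ∀ i, B i (Fin.last 3) = 0) {t : ℂ}
    (ht : (B' - t • B'ᵀ).det = 0) : (A.submatrix Fin.castSucc Fin.castSucc -
      t • (A.submatrix Fin.castSucc Fin.castSucc : Matrix (Fin 3) (Fin 3) ℂ)ᵀ).det = 0 := by
  obtain ⟨P, c, hc, hP⟩ := exists_transpose_mul_mul_eq_smul hA h
  subst hB'
  exact det_sub_smul_transpose_eq_zero_of_smul hc (submatrix_castSucc_congr hr hl hP) ht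

theorem AlgIso.det_eq_zero_two (hA : A ≠ 0) (h : AlgIso (mulOfMatrix A) (mulOfMatrix B))
    {B' : Matrix (Fin 3) (Fin 3) ℂ} (hB' : B.submatrix Fin.castSucc Fin.castSucc = B')
    {B'' : Matrix (Fin 2) (Fin 2) ℂ} (hB'' : B'.submatrix Fin.castSucc Fin.castSucc = B'')
    (hr : ∀ j, B (Fin.last 3) j = 0) (hl : ∀ i, B i (Fin.last 3) = 0)
    (hr' : ∀ j, B' (Fin.last 2) j = 0) (hl' : ∀ i, B' i (Fin.last 2) = 0) {t : ℂ}
    (ht : (B'' - t • B''ᵀ).det = 0) :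
    ((A.submatrix Fin.castSucc Fin.castSucc).submatrix Fin.castSucc Fin.castSucc - t •
      ((A.submatrix Fin.castSucc Fin.castSucc).submatrix Fin.castSucc Fin.castSucc :
        Matrix (Fin 2) (Fin 2) ℂ)ᵀ).det = 0 := by
  obtain ⟨P, c, hc, hP⟩ := exists_transpose_mul_mul_eq_smul hA h
  subst hB' hB''
  exact det_sub_smul_transpose_eq_zero_of_smul hc
    (submatrix_castSucc_congr hr' hl' (submatrix_castSucc_congr hr hl hP)) ht

end

namespace Label

/-- The number of basis vectors outside the annihilator for the algebras whose matrix pencil is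
regular on that part; the other algebras get distinct values above four. -/
def kind : Label → ℕ
  | h01 => 5
  | h02 | h03 _ => 2
  | h04 | h05 _ | h07 => 3
  | h06 => 6
  | h10 => 7
  | _ => 4

/-- The two parameters that determine the singular members of the matrix pencil of the table. -/
def roots : Label → ℂ × ℂ
  | h02 | h08 | h12 => (-1, -1)
  | h03 l | h09 l => (l, l)
  | h05 l => (l, 1)
  | h04 => (-1, 1)
  | h07 | h11 => (1, 1)
  | h13 l m => (l, m)
  | h14 l => (l, -1)
  | _ => (0, 0)

theorem kind_derDim (L : Label) : L.kind = 2 ∧ (L.derDim = 14 ∨ L.derDim = 16) ∨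
    L.kind = 3 ∧ (L.derDim = 10 ∨ L.derDim = 12) ∨
    L.kind = 4 ∧ (L.derDim = 7 ∨ L.derDim = 9 ∨ L.derDim = 11 ∨ L.derDim = 13 ∨ L.derDim = 15) ∨
    L.kind = 5 ∧ L.derDim = 17 ∨ L.kind = 6 ∧ L.derDim = 11 ∨ L.kind = 7 ∧ L.derDim = 8 := by
  have hne : (1 : ℂ) ≠ -1 := by norm_num
  cases L <;> simp only [kind, derDim, delta] <;> grind

theorem roots_mem (L : Label) (hL : L.Admissible) :
    L.roots.1 ∈ unitDiscHalf ∧ L.roots.2 ∈ unitDiscHalf := by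
  have h0 := zero_mem_unitDiscHalf
  have h1 := one_mem_unitDiscHalf
  have h2 := neg_one_mem_unitDiscHalf
  cases L <;> simp only [roots, Admissible] at * <;> tauto

theorem det_table_of_kind_eq_four (L : Label) (hL : L.kind = 4) (t : ℂ) :
    (L.table - t • L.tableᵀ).det = (1 - L.roots.1 * t) * (L.roots.1 - t) *
      ((1 - L.roots.2 * t) * (L.roots.2 - t)) := by
  cases L <;> simp only [kind, Nat.reduceEqDiff] at hL <;>
    simp [det_fin_four, table, roots] <;> ring

/-- Only the zero sets agree: the determinant has degree three, and the formula contains an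
additional factor 1 - t. -/
theorem det_table_of_kind_eq_three (L : Label) (hL : L.kind = 3) (t : ℂ) :
    (L.table.submatrix Fin.castSucc Fin.castSucc -
      t • (L.table.submatrix Fin.castSucc Fin.castSucc : Matrix (Fin 3) (Fin 3) ℂ)ᵀ).det = 0 ↔
      (1 - L.roots.1 * t) * (L.roots.1 - t) * ((1 - L.roots.2 * t) * (L.roots.2 - t)) = 0 := by
  cases L <;> simp only [kind, Nat.reduceEqDiff] at hL <;>
    simp [Matrix.det_fin_three, table, roots] <;> grind

theorem det_table_of_kind_eq_two (L : Label) (hL : L.kind = 2) (t : ℂ) :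
    ((L.table.submatrix Fin.castSucc Fin.castSucc).submatrix Fin.castSucc Fin.castSucc - t •
      ((L.table.submatrix Fin.castSucc Fin.castSucc).submatrix Fin.castSucc Fin.castSucc :
        Matrix (Fin 2) (Fin 2) ℂ)ᵀ).det = 0 ↔
      (1 - L.roots.1 * t) * (L.roots.1 - t) * ((1 - L.roots.2 * t) * (L.roots.2 - t)) = 0 := by
  cases L <;> simp only [kind, Nat.reduceEqDiff] at hL <;>
    simp [Matrix.det_fin_two, table, roots] <;> grind

theorem eq_of_factor_eq_zero {l t : ℂ} (hl : l ∈ unitDiscHalf) (ht : t ∈ unitDiscHalf)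
    (h : (1 - l * t) * (l - t) = 0) : t = l := by
  rcases mul_eq_zero.1 h with h | h
  · exact (eq_of_mul_eq_one_of_mem_unitDiscHalf hl ht (sub_eq_zero.1 h).symm).symm
  · exact (sub_eq_zero.1 h).symm

theorem table_last_row (L : Label) (hL : L.kind = 2 ∨ L.kind = 3) (j : Fin 4) :
    L.table (Fin.last 3) j = 0 := by
  cases L <;> simp only [kind, Nat.reduceEqDiff, or_self]
    at hL <;> fin_cases j <;> rfl

theorem table_last_col (L : Label) (hL : L.kind = 2 ∨ L.kind = 3) (i : Fin 4) :
    L.table i (Fin.last 3) = 0 := by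
  cases L <;> simp only [kind, Nat.reduceEqDiff, or_self]
    at hL <;> fin_cases i <;> rfl

theorem table_second_last_row (L : Label) (hL : L.kind = 2) (j : Fin 3) :
    L.table.submatrix Fin.castSucc Fin.castSucc (Fin.last 2) j = 0 := by
  cases L <;> simp only [kind, Nat.reduceEqDiff]
    at hL <;> fin_cases j <;> rfl

theorem table_second_last_col (L : Label) (hL : L.kind = 2) (i : Fin 3) :
    L.table.submatrix Fin.castSucc Fin.castSucc i (Fin.last 2) = 0 := by
  cases L <;> simp only [kind, Nat.reduceEqDiff]
    at hL <;> fin_cases i <;> rfl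

theorem roots_subset {L L' : Label} (hL : L.Admissible) (hk : L.kind = L'.kind)
    (hk4 : L.kind = 2 ∨ L.kind = 3 ∨ L.kind = 4) (h : AlgIso L.mul L'.mul) {t : ℂ}
    (ht : t ∈ unitDiscHalf) (htL : t = L'.roots.1 ∨ t = L'.roots.2) :
    t = L.roots.1 ∨ t = L.roots.2 := by
  have h' : (1 - L'.roots.1 * t) * (L'.roots.1 - t) *
      ((1 - L'.roots.2 * t) * (L'.roots.2 - t)) = 0 := by
    rcases htL with h | h <;> rw [← h] <;> ring
  suffices H : (1 - L.roots.1 * t) * (L.roots.1 - t) *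
      ((1 - L.roots.2 * t) * (L.roots.2 - t)) = 0 from
    (mul_eq_zero.1 H).imp (eq_of_factor_eq_zero (L.roots_mem hL).1 ht)
      (eq_of_factor_eq_zero (L.roots_mem hL).2 ht)
  rcases hk4 with h2 | h3 | h4
  · have h2' := hk ▸ h2
    rw [← det_table_of_kind_eq_two L h2]
    exact h.det_eq_zero_two L.table_ne_zero rfl rfl (L'.table_last_row (.inl h2'))
      (L'.table_last_col (.inl h2')) (L'.table_second_last_row h2') (L'.table_second_last_col h2')
      ((det_table_of_kind_eq_two L' h2' t).2 h')
  · have h3' := hk ▸ h3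
    rw [← det_table_of_kind_eq_three L h3]
    exact h.det_eq_zero_three L.table_ne_zero rfl (L'.table_last_row (.inr h3'))
      (L'.table_last_col (.inr h3')) ((det_table_of_kind_eq_three L' h3' t).2 h')
  · have h4' := hk ▸ h4
    rw [← det_table_of_kind_eq_four L h4]
    rw [← det_table_of_kind_eq_four L' h4'] at h'
    exact h.det_eq_zero L.table_ne_zero h'

/-- The 4×4 pencil of `h06` is singular for every t, so 0, 1 and -1 would all have to be among the
two roots of L. -/
theorem not_algIso_h06 {L : Label} (hL : L.Admissible) (hk : L.kind = 4) :
    ¬ AlgIso L.mul h06.mul := by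
  intro h
  have key (t : ℂ) (ht : t ∈ unitDiscHalf) : t = L.roots.1 ∨ t = L.roots.2 := by
    have h1 := h.det_eq_zero L.table_ne_zero (t := t) (by simp [det_fin_four, table])
    rw [det_table_of_kind_eq_four L hk] at h1
    exact (mul_eq_zero.1 h1).imp (eq_of_factor_eq_zero (L.roots_mem hL).1 ht)
      (eq_of_factor_eq_zero (L.roots_mem hL).2 ht)
  have h0 := key 0 zero_mem_unitDiscHalf
  have h1 := key 1 one_mem_unitDiscHalf
  have h2 := key (-1) neg_one_mem_unitDiscHalf
  have hne : (-1 : ℂ) ≠ 1 := by norm_num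
  have hne' : (-1 : ℂ) ≠ 0 := by norm_num
  have hne'' : (1 : ℂ) ≠ 0 := one_ne_zero
  grind

theorem eq_of_sub_mem_halfPlane {l m : ℂ} (h : l - m ∈ halfPlane) (h' : m - l ∈ halfPlane) :
    l = m := by
  simp only [halfPlane, Set.mem_union, Set.mem_ofPred_eq, Complex.sub_re, Complex.sub_im] at h h'
  apply Complex.ext <;> grind

/-- The hypotheses compare the roots as sets, without multiplicity or order. The derivation
dimension separates names with the same roots, and `halfPlane` fixes the order in `h13`. -/
theorem eq_of_kind_eq_of_roots {L L' : Label} (hL : L.Admissible) (hL' : L'.Admissible)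
    (hk : L.kind = L'.kind) (hd : L.derDim = L'.derDim)
    (h1 : L.roots.1 = L'.roots.1 ∨ L.roots.1 = L'.roots.2)
    (h2 : L.roots.2 = L'.roots.1 ∨ L.roots.2 = L'.roots.2)
    (h3 : L'.roots.1 = L.roots.1 ∨ L'.roots.1 = L.roots.2)
    (h4 : L'.roots.2 = L.roots.1 ∨ L'.roots.2 = L.roots.2) : L = L' := by
  have hne : (-1 : ℂ) ≠ 1 := by norm_num
  have hne' : (-1 : ℂ) ≠ 0 := by norm_num
  have hne'' : (1 : ℂ) ≠ 0 := one_ne_zero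
  have hlt := @eq_of_sub_mem_halfPlane
  cases L <;> cases L' <;>
    simp only [kind, Nat.reduceEqDiff] at hk <;>
    simp only [roots, derDim, delta, Admissible] at * <;> grind

end Label

theorem Label.eq_of_algIso {L L' : Label} (hL : L.Admissible) (hL' : L'.Admissible)
    (h : AlgIso L.mul L'.mul) : L = L' := by
  have hd : L.derDim = L'.derDim := by
    rw [← L.finrank_derivations hL, ← L'.finrank_derivations hL', h.finrank_derivations_eq]
  have of_kind_eq (hk : L.kind = L'.kind) (hk4 : L.kind = 2 ∨ L.kind = 3 ∨ L.kind = 4) :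
      L = L' :=
    eq_of_kind_eq_of_roots hL hL' hk hd
      (roots_subset hL' hk.symm (hk ▸ hk4) h.symm (L.roots_mem hL).1 (.inl rfl))
      (roots_subset hL' hk.symm (hk ▸ hk4) h.symm (L.roots_mem hL).2 (.inr rfl))
      (roots_subset hL hk hk4 h (L'.roots_mem hL').1 (.inl rfl))
      (roots_subset hL hk hk4 h (L'.roots_mem hL').2 (.inr rfl))
  have of_kind (M : Label) : (M.kind = 5 → M = h01) ∧ (M.kind = 6 → M = h06) ∧
      (M.kind = 7 → M = h10) := by
    cases M <;> simp [kind]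
  have hk := L.kind_derDim
  have hk' := L'.kind_derDim
  -- By `kind_derDim`, equal derivation dimensions force equal kinds, except that 11 occurs for
  -- kinds 4 and 6.
  by_cases h5 : L.kind = 5
  · rw [(of_kind L).1 h5, (of_kind L').1 (by omega)]
  by_cases h7 : L.kind = 7
  · rw [(of_kind L).2.2 h7, (of_kind L').2.2 (by omega)]
  by_cases h6 : L.kind = 6
  · have h6' := (of_kind L).2.1 h6
    by_cases h4 : L'.kind = 4
    · exact absurd (h6' ▸ h.symm) (not_algIso_h06 hL' h4)
    · rw [h6', (of_kind L').2.1 (by omega)]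
  by_cases h6' : L'.kind = 6
  · exact absurd ((of_kind L').2.1 h6' ▸ h) (not_algIso_h06 hL (by omega))
  exact of_kind_eq (by omega) (by omega)

end NCHeisenberg

theorem mainTheorem2 :
    (∀ (V : Type*) [AddCommGroup V] [Module ℂ V] (m : V →ₗ[ℂ] V →ₗ[ℂ] V),
      Module.finrank ℂ V = 5 → NCHeisenberg.IsNCHeisenberg m → m ≠ 0 →
        ∃! L : NCHeisenberg.Label, L.Admissible ∧ NCHeisenberg.AlgIso m L.mul) ∧
    (∀ L : NCHeisenberg.Label, L.Admissible →
      NCHeisenberg.IsNCHeisenberg L.mul ∧ L.mul ≠ 0 ∧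
        Module.finrank ℂ (NCHeisenberg.derivations L.mul) = L.derDim) := by
  refine ⟨fun V _ _ m hV hm h0 => ?_, fun L hL => ⟨?_, ?_, L.finrank_derivations hL⟩⟩
  · obtain ⟨L, hL, h⟩ := hm.exists_label hV h0
    exact ⟨L, ⟨hL, h⟩, fun L' h' =>
      (NCHeisenberg.Label.eq_of_algIso hL h'.1 (h.symm.trans h'.2)).symm⟩
  · exact NCHeisenberg.isNCHeisenberg_mulOfMatrix _
  · exact NCHeisenberg.mulOfMatrix_ne_zero L.table_ne_zero
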